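/- Let $\mathcal P=(\mathcal P,d,\mu)$ be a metric space with a $\sigma$-finite Borel regular measure $\mu$ (all Borel sets are $\mu$-measurable, and every $\mu$-measurable set is contained in a Borel set of the same measure) such that every ball has finite positive measure. Let $\mathcal M$ be the set of all $\mu$-measurable functions $\mathcal P\to\overline{\mathbb R}$, and let $X=\{u\in\mathcal M:\|u\|_X<\infty\}$ be a quasi-Banach function lattice whose quasi-norm is continuous. That is, functions are defined everywhere, and $\|\cdot\|_X:\mathcal M\to[0,\infty]$ satisfies, for some constant $c\ge 1$: $\|u\|_X=0$ if and only if $u=0$ a.e.; $\|au\|_X=|a|\,\|u\|_X$ for $a\in\mathbb R$; $\|u+v\|_X\le c(\|u\|_X+\|v\|_X)$; $\|u\|_X\le\|v\|_X$ whenever $|u|\le|v|$ a.e.; $\|\sum_{n\ge1}u_n\|_X\le\sum_{n\ge1}c^n\|u_n\|_X$ whenever all $u_n\ge0$ a.e.; and $\|u_n\|_X\to\|u\|_X$ whenever $\|u_n-u\|_X\to0$. A Borel function $g:\mathcal P\to[0,\infty]$ is an *upper gradient* of $u:\mathcal P\to\overline{\mathbb R}$ if $|u(\gamma(0))-u(\gamma(l_\gamma))|\le\int_\gamma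 g\,ds$ for every non-constant rectifiable curve $\gamma:[0,l_\gamma]\to\mathcal P$ parametrized by arc length, with the convention $|(\pm\infty)-(\pm\infty)|=\infty$. For $u\in\mathcal M$ put $\|u\|_{N^1X}=\|u\|_X+\inf_g\|g\|_X$, the infimum being over all upper gradients $g$ of $u$, and let $N^1X=\{u\in\mathcal M:\|u\|_{N^1X}<\infty\}$. The capacity of $E\subset\mathcal P$ is $C_X(E)=\inf\{\|u\|_{N^1X}:u\in\mathcal M,\ u\ge1\text{ on }E\}$. A function $u:\mathcal P\to\overline{\mathbb R}$ is *quasi-continuous* if for every $\varepsilon>0$ there is an open set $U\subset\mathcal P$ with $C_X(U)<\varepsilon$ such that $u|_{\mathcal P\setminus U}$ is real-valued and continuous. $X$ has the *Vitali–Carathéodory property* if for every $u\in\mathcal M$ $$\|u\|_X=\inf\{\|v\|_X: v\ge|u|\text{ on }\mathcal P,\ v\text{ lower semicontinuous on }\mathcal P\}.$$ **Corollary.** Assume that $\mathcal P$ is locally compact and that at least one of the following holds: (a) $X$ has the Vitali–Carathéodory property; (b) for every bounded measurable set $B\subset\mathcal P$, $\chi_B\in X$ and $\chi_B$ has absolutely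 continuous quasi-norm in $X$, i.e. $\|\chi_B\chi_{E_n}\|_X\to0$ for every decreasing sequence of measurable sets $E_n$ with $\mu(\bigcap_nE_n)=0$. If continuous (real-valued) functions are dense in $N^1X$ with respect to $\|\cdot\|_{N^1X}$, then every $u\in N^1X$ is quasi-continuous. -/

import Mathlib

open MeasureTheory Set Filter Topology
open scoped ENNReal NNReal

noncomputable section

/-- Borel regularity (Borel sets being measurable is the class `OpensMeasurableSpace`): every
measurable set has a Borel superset of the same measure. The measurable sets may form any
`σ`-algebra that contains the Borel sets, for instance the completed one. -/
def IsBorelRegular {P : Type*} [TopologicalSpace P] [MeasurableSpace P] (μ : Measure P) : Prop :=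
  ∀ A : Set P, MeasurableSet A → ∃ D : Set P, MeasurableSet[borel P] D ∧ A ⊆ D ∧ μ D = μ A

/-- A quasi-Banach function lattice over `(P, μ)` with a continuous quasi-norm, as a space of
extended real-valued measurable functions that are defined everywhere. The functional `qnorm` is
constrained (and used) only on measurable functions; the lattice itself consists of the measurable
functions of finite `qnorm`, see `Mem`. -/
structure QuasiBanachFunctionLattice {P : Type*} [MeasurableSpace P] (μ : Measure P) where
  /-- the functional `‖·‖_X`, with value `∞` exactly outside `X` -/
  qnorm : (P → EReal) → ℝ≥0∞
  /-- the modulus of concavity -/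
  modulus : ℝ≥0
  one_le_modulus : 1 ≤ modulus
  qnorm_eq_zero_iff : ∀ u : P → EReal, Measurable u → (qnorm u = 0 ↔ ∀ᵐ x ∂μ, u x = 0)
  qnorm_smul : ∀ (a : ℝ) (u : P → EReal), Measurable u →
    qnorm (fun x => (a : EReal) * u x) = ENNReal.ofReal |a| * qnorm u
  qnorm_add_le : ∀ u v : P → EReal, Measurable u → Measurable v →
    qnorm (fun x => u x + v x) ≤ modulus * (qnorm u + qnorm v)
  /-- the lattice property -/
  qnorm_mono : ∀ u v : P → EReal, Measurable u → Measurable v →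
    (∀ᵐ x ∂μ, (u x).abs ≤ (v x).abs) → qnorm u ≤ qnorm v
  /-- the Riesz–Fischer property; the sequence is indexed from `0`, hence the exponent `n + 1` -/
  riesz_fischer : ∀ u : ℕ → P → EReal, (∀ n, Measurable (u n)) →
    (∀ n, ∀ᵐ x ∂μ, 0 ≤ u n x) →
    qnorm (fun x => ((∑' n, (u n x).toENNReal : ℝ≥0∞) : EReal)) ≤
      ∑' n, (modulus : ℝ≥0∞) ^ (n + 1) * qnorm (u n)
  /-- continuity of the quasi-norm -/
  qnorm_continuous : ∀ (u : ℕ → P → EReal) (v : P → EReal), (∀ n, Measurable (u n)) →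
    Measurable v → Tendsto (fun n => qnorm (fun x => u n x - v x)) atTop (𝓝 0) →
    Tendsto (fun n => qnorm (u n)) atTop (𝓝 (qnorm v))

/-- `g` is an upper gradient of `u`: a Borel function with `|u(γ(0)) - u(γ(l))| ≤ ∫_γ g ds` for every
non-constant rectifiable curve `γ : [0, l] → P` parametrized by arc length. In `EReal` the difference
of two infinite values is always infinite, so `EReal.abs` gives `|(±∞) - (±∞)| = ∞`. -/
def IsUpperGradient {P : Type*} [MetricSpace P] (g : P → ℝ≥0∞) (u : P → EReal) : Prop :=
  Measurable[borel P] g ∧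
    ∀ (l : ℝ) (γ : ℝ → P), 0 < l → HasUnitSpeedOn γ (Icc 0 l) →
      (u (γ 0) - u (γ l)).abs ≤ ∫⁻ t in Icc 0 l, g (γ t)

namespace QuasiBanachFunctionLattice

variable {P : Type*} [MetricSpace P] [MeasurableSpace P] {μ : Measure P}

/-- Membership in `X`. -/
def Mem (X : QuasiBanachFunctionLattice μ) (u : P → EReal) : Prop :=
  Measurable u ∧ X.qnorm u < ∞

/-- The Vitali–Carathéodory property: the quasi-norm of every measurable function is the infimum of
the quasi-norms of the lower semicontinuous functions that majorize its absolute value everywhere. -/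
def VitaliCaratheodory (X : QuasiBanachFunctionLattice μ) : Prop :=
  ∀ u : P → EReal, Measurable u →
    X.qnorm u = ⨅ (v : P → EReal) (_ : LowerSemicontinuous v)
      (_ : ∀ x, ((u x).abs : EReal) ≤ v x), X.qnorm v

/-- The function `u` has absolutely continuous quasi-norm in `X`. -/
def HasAbsContNorm (X : QuasiBanachFunctionLattice μ) (u : P → EReal) : Prop :=
  ∀ E : ℕ → Set P, (∀ n, MeasurableSet (E n)) → Antitone E → μ (⋂ n, E n) = 0 →
    Tendsto (fun n => X.qnorm ((E n).indicator u)) atTop (𝓝 0)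

/-- `X` contains the characteristic functions of all bounded measurable sets, and these have
absolutely continuous quasi-norm in `X`. -/
def BoundedSetsAbsCont (X : QuasiBanachFunctionLattice μ) : Prop :=
  ∀ B : Set P, MeasurableSet B → Bornology.IsBounded B →
    X.Mem (B.indicator fun _ => 1) ∧ X.HasAbsContNorm (B.indicator fun _ => 1)

/-- The Newtonian quasi-seminorm `‖u‖_X + inf ‖g‖_X` over all upper gradients `g` of `u`. -/
def newtonNorm (X : QuasiBanachFunctionLattice μ) (u : P → EReal) : ℝ≥0∞ :=
  X.qnorm u + ⨅ (g : P → ℝ≥0∞) (_ : IsUpperGradient g u), X.qnorm fun x => (g x : EReal)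

/-- Membership in the Newtonian space `N¹X`. -/
def MemNewton (X : QuasiBanachFunctionLattice μ) (u : P → EReal) : Prop :=
  Measurable u ∧ X.newtonNorm u < ∞

/-- The Sobolev `X`-capacity. -/
def capacity (X : QuasiBanachFunctionLattice μ) (E : Set P) : ℝ≥0∞ :=
  ⨅ (u : P → EReal) (_ : Measurable u) (_ : ∀ x ∈ E, 1 ≤ u x), X.newtonNorm u

/-- Quasi-continuity. A continuous function is, by convention, finite-valued. -/
def QuasiContinuous (X : QuasiBanachFunctionLattice μ) (u : P → EReal) : Prop :=
  ∀ ε : ℝ, 0 < ε → ∃ U : Set P, IsOpen U ∧ X.capacity U < ENNReal.ofReal ε ∧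
    (∀ x ∈ Uᶜ, u x ≠ ⊤ ∧ u x ≠ ⊥) ∧ ContinuousOn u Uᶜ

/-- Continuous (real-valued) functions are dense in `N¹X`. -/
def ContinuousDense (X : QuasiBanachFunctionLattice μ) : Prop :=
  ∀ u : P → EReal, X.MemNewton u → ∀ ε : ℝ, 0 < ε → ∃ v : P → ℝ, Continuous v ∧
    X.MemNewton (fun x => (v x : EReal)) ∧
    X.newtonNorm (fun x => u x - (v x : EReal)) < ENNReal.ofReal ε

end QuasiBanachFunctionLattice

end

/-!
A rapidly convergent sequence of continuous functions `v n → u` in the Newtonian norm converges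
uniformly outside sets of small capacity. By the Chebyshev inequality `capacity_lt_abs_le`, the set
`H n` where `|u - v n| > 2⁻ⁿ` has tiny capacity. The sets `F n` where `|v n - v (n + 1)| > 2 · 2⁻ⁿ`
are open and lie in `H n ∪ H (n + 1)`, so that countable subadditivity (`capacity_iUnion_le`) makes
`⋃ n ≥ m, F n` an open set of small capacity off which `v n` converges uniformly. The limit is `u` off
`limsup H n`, which has capacity zero (`capacity_iInter_iUnion_eq_zero`). It remains to enclose a
set `E` of capacity zero in open sets of small capacity
(`exists_isOpen_capacity_lt_of_capacity_eq_zero`).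

The space is second countable, since balls have positive measure and the measure is `σ`-finite, so
`E` may be assumed to lie in a relatively compact open set `W`. Summing upper gradients of functions
that are admissible for the capacity of `E`, and adding `∞` on a null Borel set, gives a Borel
function of small quasi-norm whose integral along every nonconstant curve starting in `E` is infinite
(`exists_lintegral_eq_top_of_capacity_eq_zero`). It has a lower semicontinuous majorant `ρ` of small
quasi-norm (`exists_lowerSemicontinuous_ge`): this is the Vitali–Carathéodory property, or else it
follows from outer regularity and absolute continuity of the quasi-norm, applied to the level sets
of simple functions. With `V = {ρ > 1}`, let `f x` be the infimum of `∫_γ ρ` over the curves `γ`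
from `x` to the complement of `V ∩ W` (`curveDist`). Then `min 1 f` has `ρ` as an upper gradient,
is at most `ρ`, and equals `1` on `E`. Curves from `x` that have just reached the complement stay in
the compact closure of `W` and have length at most `∫_γ ρ`, so the Arzelà–Ascoli theorem and Fatou's
lemma show that `f` is lower semicontinuous (`lowerSemicontinuous_curveDist`). Hence
`{min 1 f > 1 / 2}` is an open neighbourhood of `E` of small capacity.
-/

/-! ### Separability, and curves as Lipschitz maps -/

/-- The balls of radius `ε / 2` around the points of an `ε`-separated set are disjoint and have
positive measure, so `σ`-finiteness makes every such set countable. -/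
theorem secondCountableTopology_of_sigmaFinite_of_ball_pos {P : Type*} [MetricSpace P]
    [MeasurableSpace P] [OpensMeasurableSpace P] (μ : Measure P) [SigmaFinite μ]
    (hball : ∀ (x : P) (r : ℝ), 0 < r → 0 < μ (Metric.ball x r)) :
    SecondCountableTopology P := by
  refine Metric.secondCountable_of_almost_dense_set fun ε hε => ?_
  obtain ⟨S, hS⟩ := zorn_subset {S : Set P | S.Pairwise fun x y => ε < dist x y} (by
    intro c hc hchain
    refine ⟨⋃₀ c, ?_, fun s hs => subset_sUnion_of_mem hs⟩
    exact (pairwise_sUnion hchain.directedOn).2 fun s hs => hc hs)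
  refine ⟨S, ?_, fun x => ?_⟩
  · have hc := Measure.countable_meas_pos_of_disjoint_iUnion (μ := μ)
      (As := fun x : S => Metric.ball (x : P) (ε / 2)) (fun _ => Metric.isOpen_ball.measurableSet)
      (fun x y hxy => Metric.ball_disjoint_ball (by
        have := hS.prop x.2 y.2 (fun h => hxy (Subtype.ext h))
        linarith))
    have hu : {i : S | 0 < μ (Metric.ball (i : P) (ε / 2))} = univ :=
      eq_univ_of_forall fun i => hball _ _ (half_pos hε)
    rw [hu, countable_univ_iff] at hc
    exact hc
  · by_contra! h
    have hx : x ∈ S := by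
      refine hS.le_of_ge (y := insert x S) ?_ (subset_insert _ _) (mem_insert _ _)
      refine hS.prop.insert fun y hy _ => ⟨h y hy, ?_⟩
      rw [dist_comm]; exact h y hy
    simpa using (h x hx).trans_le' hε.le

theorem tsum_lintegral_le_lintegral_tsum {α : Type*} [MeasurableSpace α] (μ : Measure α)
    (f : ℕ → α → ℝ≥0∞) : ∑' n, ∫⁻ a, f n a ∂μ ≤ ∫⁻ a, ∑' n, f n a ∂μ := by
  rw [ENNReal.tsum_eq_iSup_sum]
  refine iSup_le fun s => ?_
  have : ∑ n ∈ s, ∫⁻ a, f n a ∂μ ≤ ∫⁻ a, ∑ n ∈ s, f n a ∂μ := by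
    classical
    induction s using Finset.induction_on with
    | empty => simp
    | insert i s hi ih =>
      simp only [Finset.sum_insert hi]
      exact (add_le_add le_rfl ih).trans (le_lintegral_add _ _)
  exact this.trans (lintegral_mono fun a => ENNReal.sum_le_tsum s)

theorem LipschitzOnWith.lipschitzWith_comp_projIcc {E : Type*} [PseudoMetricSpace E] {γ : ℝ → E}
    {l : ℝ} (hl : 0 ≤ l) (hγ : LipschitzOnWith 1 γ (Icc 0 l)) :
    LipschitzWith 1 fun t => γ (projIcc 0 l hl t) := by
  have h : LipschitzWith (1 * 1) ((Icc 0 l).domRestrict γ ∘ projIcc 0 l hl) :=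
    hγ.to_restrict.comp (LipschitzWith.projIcc hl)
  rw [one_mul] at h
  exact h

theorem HasUnitSpeedOn.lipschitzOnWith {E : Type*} [PseudoMetricSpace E] {γ : ℝ → E} {s : Set ℝ}
    (h : HasUnitSpeedOn γ s) : LipschitzOnWith 1 γ s := by
  have key : ∀ x ∈ s, ∀ y ∈ s, x ≤ y → edist (γ x) (γ y) ≤ edist x y := by
    intro x hx y hy hxy
    have h1 := h hx hy
    rw [NNReal.coe_one, one_mul] at h1
    rw [edist_comm x y, edist_dist y x, Real.dist_eq, abs_of_nonneg (sub_nonneg.2 hxy), ← h1]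
    exact eVariationOn.edist_le _ ⟨hx, left_mem_Icc.2 hxy⟩ ⟨hy, right_mem_Icc.2 hxy⟩
  intro x hx y hy
  rw [ENNReal.coe_one, one_mul]
  rcases le_total x y with hxy | hxy
  · exact key x hx y hy hxy
  · rw [edist_comm, edist_comm x]
    exact key y hy x hx hxy

theorem LipschitzWith.variationOnFromTo_sub_le {E : Type*} [PseudoMetricSpace E] {γ : ℝ → E}
    (hγ : LipschitzWith 1 γ) {l a b : ℝ} (ha : a ∈ Icc 0 l) (hb : b ∈ Icc 0 l) (hab : a ≤ b) :
    variationOnFromTo γ (Icc 0 l) a b ≤ b - a := by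
  rw [variationOnFromTo.eq_of_le _ _ hab]
  refine ENNReal.toReal_le_of_le_ofReal (sub_nonneg.2 hab) ?_
  have h1 := (hγ.lipschitzOnWith (s := univ)).comp_eVariationOn_le (f := γ) (g := id)
    (s := Icc 0 l ∩ Icc a b) (fun _ _ => mem_univ _)
  rw [ENNReal.coe_one, one_mul, Function.comp_id] at h1
  refine h1.trans ?_
  exact ((monotoneOn_id (s := Icc 0 l)).eVariationOn_eq ha hb).le

/-- The inequality that defines upper gradients extends to `1`-Lipschitz curves, because passing to
arc length does not increase the line integral of a nonnegative function. -/
theorem IsUpperGradient.abs_sub_le_lintegral {P : Type*} [MetricSpace P] {g : P → ℝ≥0∞}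
    {u : P → EReal} (hg : IsUpperGradient g u) {γ : ℝ → P} (hγ : LipschitzWith 1 γ) {l : ℝ}
    (hl : 0 ≤ l) (hne : γ 0 ≠ γ l) :
    (u (γ 0) - u (γ l)).abs ≤ ∫⁻ t in Icc 0 l, g (γ t) := by
  let _ : MeasurableSpace P := borel P
  have : BorelSpace P := ⟨rfl⟩
  have h0 : (0 : ℝ) ∈ Icc 0 l := left_mem_Icc.2 hl
  have hl' : l ∈ Icc 0 l := right_mem_Icc.2 hl
  have hbv : LocallyBoundedVariationOn γ (Icc 0 l) :=
    (hγ.lipschitzOnWith (s := Icc 0 l)).locallyBoundedVariationOn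
  set s : ℝ → ℝ := variationOnFromTo γ (Icc 0 l) 0 with hs
  have hmono : MonotoneOn s (Icc 0 l) := variationOnFromTo.monotoneOn hbv h0
  have hs0 : s 0 = 0 := variationOnFromTo.self _ _ _
  have hlip : LipschitzOnWith 1 s (Icc 0 l) := by
    refine LipschitzOnWith.of_le_add fun x hx y hy => ?_
    rcases le_total x y with hxy | hxy
    · exact (hmono hx hy hxy).trans (le_add_of_nonneg_right dist_nonneg)
    · have h1 : s y + variationOnFromTo γ (Icc 0 l) y x = s x :=
        variationOnFromTo.add hbv h0 hy hx
      have h2 := hγ.variationOnFromTo_sub_le hy hx hxy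
      rw [Real.dist_eq, abs_of_nonneg (sub_nonneg.2 hxy)]
      linarith
  have himg : s '' Icc 0 l = Icc 0 (s l) := by
    refine Subset.antisymm ?_ ?_
    · rintro _ ⟨t, ht, rfl⟩
      exact ⟨hs0 ▸ hmono h0 ht ht.1, hmono ht hl' ht.2⟩
    · have := intermediate_value_Icc hl hlip.continuousOn
      rwa [hs0] at this
  have hunit := has_unit_speed_naturalParameterization γ hbv h0
  set η : ℝ → P := naturalParameterization γ (Icc 0 l) 0 with hη
  rw [← hs, himg] at hunit
  have hηs : ∀ t ∈ Icc 0 l, η (s t) = γ t := fun t ht =>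
    edist_eq_zero.1 (edist_naturalParameterization_eq_zero hbv h0 ht)
  have hL0 : 0 ≤ s l := hs0 ▸ hmono h0 hl' hl
  have hL : 0 < s l := by
    refine hL0.lt_of_ne fun h => hne ?_
    rw [← hηs 0 h0, ← hηs l hl', hs0, ← h]
  have hug := hg.2 (s l) η hL hunit
  rw [← hηs 0 h0, ← hηs l hl', hs0]
  refine hug.trans ?_
  -- both `s` and `η` are extended to the whole line so that they become continuous
  set s' : ℝ → ℝ := fun t => s (projIcc 0 l hl t) with hs'
  set η' : ℝ → P := fun t => η (projIcc 0 (s l) hL0 t) with hη'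
  have hs'lip : LipschitzWith 1 s' := hlip.lipschitzWith_comp_projIcc hl
  have hη'c : Continuous η' := (hunit.lipschitzOnWith.lipschitzWith_comp_projIcc hL0).continuous
  have hs'eq : ∀ t ∈ Icc 0 l, s' t = s t := fun t ht => by simp only [hs', projIcc_of_mem hl ht]
  have hη'eq : ∀ t ∈ Icc 0 (s l), η' t = η t := fun t ht => by
    simp only [hη', projIcc_of_mem hL0 ht]
  -- a `1`-Lipschitz map of the line does not increase Lebesgue measure
  have hmeas : volume.restrict (Icc 0 (s l)) ≤ (volume.restrict (Icc 0 l)).map s' := by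
    refine Measure.le_iff.2 fun A hA => ?_
    rw [Measure.restrict_apply hA, Measure.map_apply hs'lip.continuous.measurable hA,
      Measure.restrict_apply (hs'lip.continuous.measurable hA)]
    have hsub : A ∩ Icc 0 (s l) ⊆ s' '' (s' ⁻¹' A ∩ Icc 0 l) := by
      rintro y ⟨hyA, hy⟩
      rw [← himg] at hy
      obtain ⟨t, ht, rfl⟩ := hy
      exact ⟨t, ⟨by rwa [mem_preimage, hs'eq t ht], ht⟩, hs'eq t ht⟩
    refine (measure_mono hsub).trans ?_
    have := hs'lip.hausdorffMeasure_image_le (d := 1) zero_le_one (s' ⁻¹' A ∩ Icc 0 l)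
    simpa [hausdorffMeasure_real] using this
  calc ∫⁻ t in Icc 0 (s l), g (η t) = ∫⁻ t in Icc 0 (s l), g (η' t) :=
        setLIntegral_congr_fun measurableSet_Icc fun t ht => by simp only [hη'eq t ht]
    _ ≤ ∫⁻ t, g (η' t) ∂(volume.restrict (Icc 0 l)).map s' := lintegral_mono' hmeas le_rfl
    _ = ∫⁻ t in Icc 0 l, g (η' (s' t)) :=
        lintegral_map (hg.1.comp hη'c.measurable) hs'lip.continuous.measurable
    _ = ∫⁻ t in Icc 0 l, g (γ t) := by
        refine setLIntegral_congr_fun measurableSet_Icc fun t ht => ?_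
        have : s t ∈ Icc 0 (s l) := himg ▸ mem_image_of_mem s ht
        simp only [hs'eq t ht, hη'eq _ this, hηs t ht]

/-! ### The distance to a closed set weighted by a density -/

/-- The least integral of `ρ` along a curve from `x` to the set `F`. Competitors are `1`-Lipschitz
maps of an interval instead of curves parametrized by arc length, since the former are stable under
uniform limits. -/
noncomputable def curveDist {P : Type*} [MetricSpace P] (ρ : P → ℝ≥0∞) (F : Set P) (x : P) : ℝ≥0∞ :=
  ⨅ (γ : ℝ → P) (l : ℝ) (_ : 0 ≤ l) (_ : LipschitzWith 1 γ) (_ : γ 0 = x) (_ : γ l ∈ F),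
    ∫⁻ t in Icc 0 l, ρ (γ t)

section CurveDist

variable {P : Type*} [MetricSpace P] {ρ : P → ℝ≥0∞} {F : Set P}

theorem curveDist_le {γ : ℝ → P} {l : ℝ} (hl : 0 ≤ l) (hγ : LipschitzWith 1 γ) (hF : γ l ∈ F) :
    curveDist ρ F (γ 0) ≤ ∫⁻ t in Icc 0 l, ρ (γ t) :=
  iInf_le_of_le γ <| iInf_le_of_le l <| iInf_le_of_le hl <| iInf_le_of_le hγ <|
    iInf_le_of_le rfl <| iInf_le _ hF

theorem exists_curve_of_curveDist_lt {x : P} {b : ℝ≥0∞} (h : curveDist ρ F x < b) :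
    ∃ (γ : ℝ → P) (l : ℝ), 0 ≤ l ∧ LipschitzWith 1 γ ∧ γ 0 = x ∧ γ l ∈ F ∧
      ∫⁻ t in Icc 0 l, ρ (γ t) < b := by
  simp only [curveDist, iInf_lt_iff] at h
  obtain ⟨γ, l, h1, h2, h3, h4, h5⟩ := h
  exact ⟨γ, l, h1, h2, h3, h4, h5⟩

theorem curveDist_eq_zero {x : P} (hx : x ∈ F) : curveDist ρ F x = 0 := by
  refine le_antisymm ?_ zero_le
  refine (curveDist_le (ρ := ρ) (F := F) (γ := fun _ => x) le_rfl
    ((LipschitzWith.const x).weaken zero_le) hx).trans ?_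
  simp

theorem LipschitzWith.concat {γ σ : ℝ → P} {l : ℝ} (hγ : LipschitzWith 1 γ)
    (hσ : LipschitzWith 1 σ) (h : γ l = σ 0) :
    LipschitzWith 1 fun t => if t ≤ l then γ t else σ (t - l) := by
  have hγ' := fun x y => hγ.dist_le_mul x y
  have hσ' := fun x y => hσ.dist_le_mul x y
  simp only [NNReal.coe_one, one_mul] at hγ' hσ'
  have key : ∀ x y : ℝ, x ≤ y → dist (if x ≤ l then γ x else σ (x - l))
      (if y ≤ l then γ y else σ (y - l)) ≤ y - x := by
    intro x y hxy
    split_ifs with h1 h2 h2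
    · refine (hγ' x y).trans_eq ?_
      rw [dist_comm, Real.dist_eq, abs_of_nonneg (sub_nonneg.2 hxy)]
    · calc dist (γ x) (σ (y - l)) ≤ dist (γ x) (γ l) + dist (σ 0) (σ (y - l)) := by
            rw [← h]; exact dist_triangle _ _ _
        _ ≤ dist x l + dist 0 (y - l) := add_le_add (hγ' _ _) (hσ' _ _)
        _ = y - x := by
            rw [dist_comm, Real.dist_eq, abs_of_nonneg (sub_nonneg.2 h1), dist_comm, Real.dist_eq,
              abs_of_nonneg (by linarith [not_le.1 h2])]
            ring
    · exact absurd (hxy.trans h2) h1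
    · refine (hσ' _ _).trans_eq ?_
      rw [dist_comm, Real.dist_eq, abs_of_nonneg (by linarith)]
      ring
  refine LipschitzWith.of_dist_le_mul fun x y => ?_
  rw [NNReal.coe_one, one_mul]
  rcases le_total x y with hxy | hxy
  · rw [dist_comm x y, Real.dist_eq, abs_of_nonneg (sub_nonneg.2 hxy)]
    exact key x y hxy
  · rw [dist_comm, Real.dist_eq, abs_of_nonneg (sub_nonneg.2 hxy)]
    exact key y x hxy

theorem curveDist_le_add {γ : ℝ → P} {l : ℝ} (hl : 0 ≤ l) (hγ : LipschitzWith 1 γ) :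
    curveDist ρ F (γ 0) ≤ curveDist ρ F (γ l) + ∫⁻ t in Icc 0 l, ρ (γ t) := by
  refine le_of_forall_gt fun b hb => ?_
  obtain ⟨c, hc, hcb⟩ : ∃ c, curveDist ρ F (γ l) < c ∧
      c + ∫⁻ t in Icc 0 l, ρ (γ t) ≤ b := by
    refine ⟨b - ∫⁻ t in Icc 0 l, ρ (γ t), lt_tsub_iff_right.2 hb, ?_⟩
    exact (tsub_add_cancel_of_le (le_add_self.trans hb.le)).le
  obtain ⟨σ, m, hm, hσ, hσ0, hσm, hint⟩ := exists_curve_of_curveDist_lt hc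
  set η : ℝ → P := fun t => if t ≤ l then γ t else σ (t - l) with hη
  have hlip : LipschitzWith 1 η := hγ.concat hσ hσ0.symm
  have hη0 : η 0 = γ 0 := if_pos hl
  have hησ : ∀ t, l ≤ t → η t = σ (t - l) := by
    intro t ht
    rcases ht.eq_or_lt with rfl | ht
    · simp [hη, hσ0]
    · exact if_neg (not_le.2 ht)
  have hend : η (l + m) ∈ F := by rw [hησ _ (by linarith), add_sub_cancel_left]; exact hσm
  rw [← hη0]
  have hne : ∫⁻ t in Icc 0 l, ρ (γ t) ≠ ∞ := ne_top_of_lt (le_add_self.trans_lt hb)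
  refine (curveDist_le (by linarith) hlip hend).trans_lt ?_
  calc ∫⁻ t in Icc 0 (l + m), ρ (η t)
      = ∫⁻ t in Icc 0 l ∪ Icc l (l + m), ρ (η t) := by
        rw [Icc_union_Icc_eq_Icc hl (by linarith)]
    _ ≤ (∫⁻ t in Icc 0 l, ρ (η t)) + ∫⁻ t in Icc l (l + m), ρ (η t) := lintegral_union_le _ _ _
    _ = (∫⁻ t in Icc 0 l, ρ (γ t)) + ∫⁻ t in Icc 0 m, ρ (σ t) := by
        congr 1
        · exact setLIntegral_congr_fun measurableSet_Icc fun t ht => by simp only [hη, if_pos ht.2]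
        · have hpre : (fun t : ℝ => t - l) ⁻¹' Icc 0 m = Icc l (l + m) := by
            ext t; simp [add_comm]
          rw [setLIntegral_congr_fun (g := fun t => ρ (σ (t - l))) measurableSet_Icc
            fun t ht => by simp only [hησ t ht.1], ← hpre]
          exact (measurePreserving_sub_right volume l).setLIntegral_comp_preimage_emb
            (MeasurableEquiv.subRight l).measurableEmbedding (fun t => ρ (σ t)) (Icc 0 m)
    _ < (∫⁻ t in Icc 0 l, ρ (γ t)) + c := ENNReal.add_lt_add_left hne hint
    _ ≤ b := by rw [add_comm]; exact hcb

theorem curveDist_le_add' {γ : ℝ → P} {l : ℝ} (hl : 0 ≤ l) (hγ : LipschitzWith 1 γ) :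
    curveDist ρ F (γ l) ≤ curveDist ρ F (γ 0) + ∫⁻ t in Icc 0 l, ρ (γ t) := by
  have hrev : LipschitzWith 1 fun t => γ (l - t) := by
    refine LipschitzWith.of_dist_le_mul fun x y => (hγ.dist_le_mul _ _).trans_eq ?_
    rw [dist_sub_left]
  have := curveDist_le_add (ρ := ρ) (F := F) hl hrev
  simp only [sub_zero, sub_self] at this
  refine this.trans_eq ?_
  congr 1
  have hpre : (fun t : ℝ => l - t) ⁻¹' Icc 0 l = Icc 0 l := by
    ext t; simp [and_comm]
  conv_lhs => rw [← hpre]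
  exact (Measure.measurePreserving_sub_left volume l).setLIntegral_comp_preimage_emb
    (MeasurableEquiv.subLeft l).measurableEmbedding (fun t => ρ (γ t)) (Icc 0 l)

/-- A curve from `x` to `F` may be stopped when it first meets `F`. If `ρ ≥ 1` off `F`, then the
integral of `ρ` bounds the length of the stopped curve. -/
theorem exists_stopped_curve {K : Set P} (hF : IsClosed F) (hK : IsClosed K) (hFK : Fᶜ ⊆ K)
    (hρ : ∀ x ∉ F, 1 ≤ ρ x) {γ : ℝ → P} {l : ℝ} (hl : 0 ≤ l) (hγ : LipschitzWith 1 γ)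
    (h0 : γ 0 ∉ F) (hlF : γ l ∈ F) {b : ℝ} (hb : 0 ≤ b)
    (hint : ∫⁻ t in Icc 0 l, ρ (γ t) ≤ ENNReal.ofReal b) :
    ∃ (σ : ℝ → P) (m : ℝ), m ∈ Icc 0 b ∧ LipschitzWith 1 σ ∧ σ 0 = γ 0 ∧ σ m ∈ F ∧
      (∀ t, σ t ∈ K) ∧ ∫⁻ t in Icc 0 m, ρ (σ t) ≤ ENNReal.ofReal b := by
  obtain ⟨m, ⟨hm, hmF⟩, hmin⟩ := (isCompact_Icc.inter_right (hF.preimage hγ.continuous)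
    : IsCompact (Icc 0 l ∩ γ ⁻¹' F)).exists_isLeast ⟨l, right_mem_Icc.2 hl, hlF⟩
  have hm0 : 0 < m := hm.1.lt_of_ne fun h => h0 (by rw [h]; exact hmF)
  have hoff : ∀ t ∈ Ico 0 m, γ t ∉ F := fun t ht hF =>
    (hmin ⟨⟨ht.1, ht.2.le.trans hm.2⟩, hF⟩).not_gt ht.2
  have hσ : ∀ t ∈ Icc 0 m, γ (projIcc 0 m hm.1 t) = γ t := fun t ht => by
    rw [projIcc_of_mem hm.1 ht]
  have hint' : ∫⁻ t in Icc 0 m, ρ (γ t) ≤ ENNReal.ofReal b :=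
    (lintegral_mono_set (Icc_subset_Icc_right hm.2)).trans hint
  refine ⟨fun t => γ (projIcc 0 m hm.1 t), m, ⟨hm.1, ?_⟩,
    hγ.lipschitzOnWith.lipschitzWith_comp_projIcc hm.1, hσ 0 (left_mem_Icc.2 hm.1), ?_, ?_, ?_⟩
  · rw [← ENNReal.ofReal_le_ofReal_iff hb]
    calc ENNReal.ofReal m = ∫⁻ _ in Ico 0 m, (1 : ℝ≥0∞) := by simp
      _ ≤ ∫⁻ t in Ico 0 m, ρ (γ t) := setLIntegral_mono' measurableSet_Ico fun t ht =>
          hρ _ (hoff t ht)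
      _ ≤ _ := (lintegral_mono_set Ico_subset_Icc_self).trans hint'
  · exact (congrArg (· ∈ F) (hσ m (right_mem_Icc.2 hm.1))).mpr hmF
  · intro t
    have hmaps : MapsTo γ (Ico 0 m) K := fun t ht => hFK (hoff t ht)
    have := hmaps.closure hγ.continuous
    rw [closure_Ico hm0.ne, hK.closure_eq] at this
    exact this (projIcc 0 m hm.1 t).2
  · refine (setLIntegral_congr_fun measurableSet_Icc fun t ht => ?_).trans_le hint'
    exact congrArg ρ (hσ t ht)

/-- Compactness of bounded families of curves: Arzelà–Ascoli gives a uniformly convergent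
subsequence, and Fatou's lemma passes to the limit in the integrals. -/
theorem exists_limit_curve {K : Set P} (hK : IsCompact K) (hF : IsClosed F)
    (hρ : LowerSemicontinuous ρ) {γ : ℕ → ℝ → P} {m : ℕ → ℝ} {b : ℝ} {B : ℝ≥0∞}
    (hγ : ∀ n, LipschitzWith 1 (γ n)) (hm : ∀ n, m n ∈ Icc 0 b) (hmF : ∀ n, γ n (m n) ∈ F)
    (hγK : ∀ n t, γ n t ∈ K) (hint : ∀ n, ∫⁻ t in Icc 0 (m n), ρ (γ n t) ≤ B)
    {x : P} (hx : Tendsto (fun n => γ n 0) atTop (𝓝 x)) :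
    curveDist ρ F x ≤ B := by
  have hb : 0 ≤ b := (hm 0).1.trans (hm 0).2
  let A : Set (BoundedContinuousFunction (Icc 0 b) P) :=
    {f | (∀ t, f t ∈ K) ∧ LipschitzWith 1 f}
  have hAc : IsCompact (closure A) := by
    refine BoundedContinuousFunction.arzela_ascoli K hK A (fun f t hf => hf.1 t) ?_
    exact (LipschitzWith.uniformEquicontinuous _ 1 fun f : A => f.2.2).equicontinuous
  let f : ℕ → BoundedContinuousFunction (Icc 0 b) P := fun n =>
    BoundedContinuousFunction.mkOfCompact
      ⟨fun t => γ n t, (hγ n).continuous.comp continuous_subtype_val⟩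
  have hfA : ∀ n, f n ∈ A := fun n => ⟨fun t => hγK n t, fun s t => hγ n s t⟩
  obtain ⟨⟨G, τ⟩, ⟨-, hτ⟩, φ, hφ, hlim⟩ :=
    (hAc.prod (isCompact_Icc (a := 0) (b := b))).tendsto_subseq
      (x := fun n => (f n, m n)) fun n => ⟨subset_closure (hfA n), hm n⟩
  rw [nhds_prod_eq] at hlim
  have hG : Tendsto (fun n => f (φ n)) atTop (𝓝 G) := hlim.fst
  have hmτ : Tendsto (fun n => m (φ n)) atTop (𝓝 τ) := hlim.snd
  have hGpt : ∀ t, Tendsto (fun n => f (φ n) t) atTop (𝓝 (G t)) := fun t =>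
    ((BoundedContinuousFunction.lipschitz_eval_const t).continuous.tendsto G).comp hG
  have hGlip : LipschitzWith 1 G := by
    intro s t
    exact le_of_tendsto' ((hGpt s).edist (hGpt t)) fun n => (hfA (φ n)).2 s t
  set σ : ℝ → P := fun t => G (projIcc 0 b hb t) with hσ
  have hσlip : LipschitzWith 1 σ := by
    have := hGlip.comp (LipschitzWith.projIcc hb)
    rw [one_mul] at this
    exact this
  have hσpt : ∀ t ∈ Icc 0 b, Tendsto (fun n => γ (φ n) t) atTop (𝓝 (σ t)) := by
    intro t ht
    have := hGpt ⟨t, ht⟩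
    simp only [hσ, projIcc_of_mem hb ht]
    exact this
  have hσ0 : σ 0 = x := tendsto_nhds_unique (hσpt 0 (left_mem_Icc.2 hb)) (hx.comp hφ.tendsto_atTop)
  have hστ : σ τ ∈ F := by
    refine hF.mem_of_tendsto (f := fun n => γ (φ n) (m (φ n))) (b := atTop) ?_
      (Eventually.of_forall fun n => hmF _)
    have h1 := hσpt τ hτ
    refine h1.congr_dist ?_
    refine squeeze_zero (fun _ => dist_nonneg) (fun n => ?_)
      (g := fun n => dist τ (m (φ n))) (by simpa using (tendsto_const_nhds (x := τ)).dist hmτ)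
    simpa using (hγ (φ n)).dist_le_mul τ (m (φ n))
  rw [← hσ0]
  refine (curveDist_le hτ.1 hσlip hστ).trans ?_
  let _ : MeasurableSpace P := borel P
  have : BorelSpace P := ⟨rfl⟩
  have hρm : Measurable ρ := hρ.measurable
  calc ∫⁻ t in Icc 0 τ, ρ (σ t) = ∫⁻ t in Ico 0 τ, ρ (σ t) :=
        setLIntegral_congr Ico_ae_eq_Icc.symm
    _ = ∫⁻ t, (Ico 0 τ).indicator (fun t => ρ (σ t)) t :=
        (lintegral_indicator measurableSet_Ico _).symm
    _ ≤ ∫⁻ t, liminf (fun n => (Icc 0 (m (φ n))).indicator (fun t => ρ (γ (φ n) t)) t) atTop := by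
        refine lintegral_mono fun t => ?_
        by_cases ht : t ∈ Ico 0 τ
        · rw [indicator_of_mem ht]
          have hlow : ρ (σ t) ≤ liminf (fun n => ρ (γ (φ n) t)) atTop := by
            refine le_of_forall_lt fun c hc => ?_
            obtain ⟨d, hcd, hd⟩ := exists_between hc
            have hev := (hσpt t ⟨ht.1, ht.2.le.trans hτ.2⟩).eventually (hρ (σ t) d hd)
            exact hcd.trans_le (le_liminf_of_le (h := hev.mono fun n h => h.le))
          refine hlow.trans_eq (liminf_congr ?_)
          filter_upwards [hmτ.eventually (lt_mem_nhds ht.2)] with n hn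
          rw [indicator_of_mem (show t ∈ Icc 0 (m (φ n)) from ⟨ht.1, hn.le⟩)]
        · rw [indicator_of_notMem ht]
          exact zero_le
    _ ≤ liminf (fun n => ∫⁻ t, (Icc 0 (m (φ n))).indicator (fun t => ρ (γ (φ n) t)) t) atTop :=
        lintegral_liminf_le fun n =>
          (hρm.comp (hγ (φ n)).continuous.measurable).indicator measurableSet_Icc
    _ ≤ B := by
        refine liminf_le_of_le (by isBoundedDefault) fun c hc => ?_
        obtain ⟨n, hn⟩ := hc.exists
        rw [lintegral_indicator measurableSet_Icc] at hn
        exact hn.trans (hint _)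

theorem lowerSemicontinuous_curveDist {K : Set P} (hK : IsCompact K) (hF : IsClosed F)
    (hFK : Fᶜ ⊆ K) (hρ1 : ∀ x ∉ F, 1 ≤ ρ x) (hρ : LowerSemicontinuous ρ) :
    LowerSemicontinuous (curveDist ρ F) := by
  rw [lowerSemicontinuous_iff_isClosed_preimage]
  intro a
  refine isClosed_of_closure_subset fun x hx => ?_
  obtain ⟨y, hya, hyx⟩ := mem_closure_iff_seq_limit.1 hx
  by_cases hxF : x ∈ F
  · rw [mem_preimage, mem_Iic, curveDist_eq_zero hxF]
    exact zero_le
  rw [mem_preimage, mem_Iic]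
  refine le_of_forall_gt_imp_ge_of_dense fun c hc => ?_
  rcases eq_or_ne c ∞ with rfl | hctop
  · exact le_top
  obtain ⟨N, hN⟩ := eventually_atTop.1 (hyx.eventually (hF.isOpen_compl.mem_nhds hxF))
  have hex : ∀ n, ∃ (σ : ℝ → P) (m : ℝ), m ∈ Icc 0 c.toReal ∧ LipschitzWith 1 σ ∧
      σ 0 = y (n + N) ∧ σ m ∈ F ∧ (∀ t, σ t ∈ K) ∧
      ∫⁻ t in Icc 0 m, ρ (σ t) ≤ ENNReal.ofReal c.toReal := by
    intro n
    have hlt : curveDist ρ F (y (n + N)) < c := (mem_Iic.1 (hya _)).trans_lt hc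
    obtain ⟨γ, l, hl, hγ, hγ0, hγl, hint⟩ := exists_curve_of_curveDist_lt hlt
    rw [← hγ0]
    refine exists_stopped_curve hF hK.isClosed hFK hρ1 hl hγ ?_ hγl ENNReal.toReal_nonneg ?_
    · rw [hγ0]; exact hN _ (Nat.le_add_left _ _)
    · rw [ENNReal.ofReal_toReal hctop]; exact hint.le
  choose σ m hm hσ hσ0 hσm hσK hint using hex
  rw [← ENNReal.ofReal_toReal hctop]
  refine exists_limit_curve hK hF hρ hσ hm hσm hσK hint ?_
  simp only [hσ0]
  exact hyx.comp (tendsto_add_atTop_nat N)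

end CurveDist

/-! ### Quasi-norms of nonnegative functions, and capacity -/

@[simp]
theorem EReal.abs_coe_ennreal (a : ℝ≥0∞) : (a : EReal).abs = a := by
  induction a with
  | top => rfl
  | coe a =>
    rw [EReal.coe_nnreal_eq_coe_real, EReal.abs_def]
    simp

theorem EReal.abs_eq_toENNReal_max (a : EReal) : a.abs = (max a (-a)).toENNReal := by
  induction a with
  | bot => simp
  | top => simp
  | coe a =>
    rw [EReal.abs_def, ← EReal.coe_neg, ← EReal.coe_strictMono.monotone.map_max,
      EReal.toENNReal_of_ne_top (by simp)]
    rfl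

theorem EReal.measurable_abs : Measurable EReal.abs := by
  have : EReal.abs = fun a => (max a (-a)).toENNReal := funext EReal.abs_eq_toENNReal_max
  rw [this]
  exact (measurable_id.max continuous_neg.measurable).ereal_toENNReal

namespace QuasiBanachFunctionLattice

variable {P : Type*} [MeasurableSpace P] {μ : Measure P}

/-- The quasi-norm of a function with values in `[0, ∞]`. -/
noncomputable def posNorm (X : QuasiBanachFunctionLattice μ) (f : P → ℝ≥0∞) : ℝ≥0∞ :=
  X.qnorm fun x => (f x : EReal)

variable (X : QuasiBanachFunctionLattice μ) {f g : P → ℝ≥0∞}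

theorem qnorm_eq_posNorm_abs {u : P → EReal} (hu : Measurable u) :
    X.qnorm u = X.posNorm fun x => (u x).abs := by
  have hm : Measurable fun x => ((u x).abs : EReal) :=
    (EReal.measurable_abs.comp hu).coe_ereal_ennreal
  exact le_antisymm (X.qnorm_mono _ _ hu hm (ae_of_all _ fun x => by simp))
    (X.qnorm_mono _ _ hm hu (ae_of_all _ fun x => by simp))

theorem posNorm_mono_ae (hf : Measurable f) (hg : Measurable g) (h : ∀ᵐ x ∂μ, f x ≤ g x) :
    X.posNorm f ≤ X.posNorm g :=
  X.qnorm_mono _ _ hf.coe_ereal_ennreal hg.coe_ereal_ennreal (h.mono fun x hx => by simpa using hx)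

theorem posNorm_mono (hf : Measurable f) (hg : Measurable g) (h : ∀ x, f x ≤ g x) :
    X.posNorm f ≤ X.posNorm g :=
  X.posNorm_mono_ae hf hg (ae_of_all _ h)

theorem posNorm_eq_zero_iff (hf : Measurable f) : X.posNorm f = 0 ↔ ∀ᵐ x ∂μ, f x = 0 := by
  rw [posNorm, X.qnorm_eq_zero_iff _ hf.coe_ereal_ennreal]
  simp

theorem posNorm_add_le (hf : Measurable f) (hg : Measurable g) :
    X.posNorm (fun x => f x + g x) ≤ X.modulus * (X.posNorm f + X.posNorm g) := by
  have := X.qnorm_add_le _ _ hf.coe_ereal_ennreal hg.coe_ereal_ennreal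
  simpa only [posNorm, EReal.coe_ennreal_add] using this

theorem posNorm_const_mul (a : ℝ≥0) (hf : Measurable f) :
    X.posNorm (fun x => a * f x) = a * X.posNorm f := by
  have := X.qnorm_smul a _ hf.coe_ereal_ennreal
  simp only [abs_of_nonneg a.coe_nonneg, ENNReal.ofReal_coe_nnreal] at this
  rw [posNorm, posNorm, ← this]
  congr 1 with x
  rw [EReal.coe_ennreal_mul]
  rfl

theorem posNorm_tsum_le {f : ℕ → P → ℝ≥0∞} (hf : ∀ n, Measurable (f n)) :
    X.posNorm (fun x => ∑' n, f n x) ≤ ∑' n, (X.modulus : ℝ≥0∞) ^ (n + 1) * X.posNorm (f n) := by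
  have := X.riesz_fischer (fun n x => (f n x : EReal)) (fun n => (hf n).coe_ereal_ennreal)
    fun n => ae_of_all _ fun x => EReal.coe_ennreal_nonneg _
  simpa only [posNorm, EReal.toENNReal_coe] using this

theorem one_le_modulus' : (1 : ℝ≥0∞) ≤ X.modulus := by exact_mod_cast X.one_le_modulus

/-- A sequence of weights that compensates the powers of the modulus of concavity. -/
theorem exists_pos_tsum_modulus_lt {ε : ℝ≥0∞} (hε : ε ≠ 0) :
    ∃ δ : ℕ → ℝ≥0∞, (∀ n, δ n ≠ 0) ∧ ∑' n, (X.modulus : ℝ≥0∞) ^ (n + 1) * δ n < ε := by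
  obtain ⟨δ, hδ, hsum⟩ := ENNReal.exists_pos_sum_of_countable' hε ℕ
  have hc0 : (X.modulus : ℝ≥0∞) ≠ 0 := (zero_lt_one.trans_le X.one_le_modulus').ne'
  refine ⟨fun n => ((X.modulus : ℝ≥0∞) ^ (n + 1))⁻¹ * δ n, fun n => ?_, ?_⟩
  · exact mul_ne_zero (ENNReal.inv_ne_zero.2 (ENNReal.pow_ne_top ENNReal.coe_ne_top)) (hδ n).ne'
  · refine (ENNReal.tsum_le_tsum fun n => ?_).trans_lt hsum
    rw [← mul_assoc, ENNReal.mul_inv_cancel (pow_ne_zero _ hc0)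
      (ENNReal.pow_ne_top ENNReal.coe_ne_top), one_mul]

/-- A function of finite quasi-norm is finite almost everywhere: the quasi-norm of the
characteristic function of `{f = ∞}` is at most `‖f‖ / n` for every `n`. -/
theorem measure_eq_top_eq_zero (hf : Measurable f) (h : X.posNorm f ≠ ∞) :
    μ {x | f x = ∞} = 0 := by
  have hS : MeasurableSet {x | f x = ∞} := hf (measurableSet_singleton ∞)
  set χ : P → ℝ≥0∞ := {x | f x = ∞}.indicator 1 with hχ
  have hχm : Measurable χ := measurable_one.indicator hS
  have hle : ∀ n : ℕ, (n : ℝ≥0∞) * X.posNorm χ ≤ X.posNorm f := by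
    intro n
    have := X.posNorm_const_mul n hχm
    simp only [ENNReal.coe_natCast] at this
    rw [← this]
    refine X.posNorm_mono (hχm.const_mul _) hf fun x => ?_
    by_cases hx : f x = ∞
    · simp [hx]
    · simp [hχ, hx]
  have hzero : X.posNorm χ = 0 := by
    by_contra h0
    obtain ⟨n, hn⟩ := ENNReal.exists_nat_mul_gt h0 h
    exact (hle n).not_gt hn
  rw [X.posNorm_eq_zero_iff hχm] at hzero
  refine measure_mono_null (fun x hx => ?_) hzero
  simp only [mem_ofPred_eq] at hx
  simp [hχ, hx]

end QuasiBanachFunctionLattice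

/-- The distance in `EReal` of two elements of `[0, ∞]`, where `∞ - ∞` has infinite modulus. -/
theorem EReal.abs_coe_ennreal_sub_coe_ennreal_le_iff {a b I : ℝ≥0∞} :
    ((a : EReal) - b).abs ≤ I ↔ I = ∞ ∨ (a ≠ ∞ ∧ b ≠ ∞ ∧ a ≤ b + I ∧ b ≤ a + I) := by
  induction I with
  | top => simp
  | coe I =>
    induction a with
    | top =>
      have : ((⊤ : EReal) - b).abs = ⊤ := by
        induction b with
        | top => rfl
        | coe b => rw [EReal.coe_nnreal_eq_coe_real]; rfl
      simp [this]
    | coe a =>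
      induction b with
      | top => 
        have : (((a : ℝ≥0∞) : EReal) - ⊤).abs = ⊤ := by
          rw [EReal.coe_nnreal_eq_coe_real]; rfl
        simp
      | coe b =>
        rw [EReal.coe_nnreal_eq_coe_real, EReal.coe_nnreal_eq_coe_real, ← EReal.coe_sub,
          EReal.abs_def, ENNReal.ofReal_le_coe, abs_le]
        simp only [ENNReal.coe_ne_top, not_false_eq_true, ne_eq, true_and, false_or]
        norm_cast
        rw [← NNReal.coe_le_coe, ← NNReal.coe_le_coe]
        push_cast
        constructor <;> rintro ⟨h1, h2⟩ <;> constructor <;> linarith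

theorem EReal.abs_abs_sub_abs_le (a b : EReal) : ((a.abs : EReal) - b.abs).abs ≤ (a - b).abs := by
  induction a with
  | bot => induction b <;> simp
  | top => induction b <;> simp
  | coe a =>
    induction b with
    | bot => simp
    | top => simp
    | coe b =>
      rw [EReal.coe_abs, EReal.coe_abs, ← EReal.coe_sub, ← EReal.coe_sub, EReal.abs_def,
        EReal.abs_def]
      exact ENNReal.ofReal_le_ofReal (abs_abs_sub_abs_le_abs_sub a b)

theorem IsUpperGradient.abs {P : Type*} [MetricSpace P] {g : P → ℝ≥0∞} {u : P → EReal}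
    (h : IsUpperGradient g u) : IsUpperGradient g fun x => ((u x).abs : EReal) :=
  ⟨h.1, fun l γ hl hγ => (EReal.abs_abs_sub_abs_le _ _).trans (h.2 l γ hl hγ)⟩

theorem measurable_tsum_ennreal {α : Type*} {m : MeasurableSpace α} {f : ℕ → α → ℝ≥0∞}
    (h : ∀ n, Measurable[m] (f n)) : Measurable[m] fun x => ∑' n, f n x :=
  .tsum h

/-- For functions with finite nonnegative values the inequality that defines upper gradients may be
checked on Lipschitz curves, in both directions. -/
theorem IsUpperGradient.of_le_add {P : Type*} [MetricSpace P] {g f : P → ℝ≥0∞}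
    (hg : Measurable[borel P] g) (hfin : ∀ x, f x ≠ ∞)
    (h : ∀ (l : ℝ) (γ : ℝ → P), 0 < l → HasUnitSpeedOn γ (Icc 0 l) →
      f (γ 0) ≤ f (γ l) + ∫⁻ t in Icc 0 l, g (γ t) ∧
      f (γ l) ≤ f (γ 0) + ∫⁻ t in Icc 0 l, g (γ t)) :
    IsUpperGradient g fun x => (f x : EReal) :=
  ⟨hg, fun l γ hl hγ => EReal.abs_coe_ennreal_sub_coe_ennreal_le_iff.2 <|
    Or.inr ⟨hfin _, hfin _, h l γ hl hγ⟩⟩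

theorem IsUpperGradient.le_add {P : Type*} [MetricSpace P] {g f : P → ℝ≥0∞}
    (h : IsUpperGradient g fun x => (f x : EReal)) {l : ℝ} {γ : ℝ → P} (hl : 0 < l)
    (hγ : HasUnitSpeedOn γ (Icc 0 l)) :
      f (γ 0) ≤ f (γ l) + ∫⁻ t in Icc 0 l, g (γ t) ∧
      f (γ l) ≤ f (γ 0) + ∫⁻ t in Icc 0 l, g (γ t) := by
  rcases EReal.abs_coe_ennreal_sub_coe_ennreal_le_iff.1 (h.2 l γ hl hγ) with h | h
  · simp [h]
  · exact h.2.2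

namespace QuasiBanachFunctionLattice

variable {P : Type*} [MetricSpace P] [MeasurableSpace P] {μ : Measure P}
  (X : QuasiBanachFunctionLattice μ)

theorem exists_upperGradient_of_newtonNorm_lt {u : P → EReal} (hu : Measurable u) {δ : ℝ≥0∞}
    (h : X.newtonNorm u < δ) : ∃ g : P → ℝ≥0∞, IsUpperGradient g u ∧
      X.posNorm (fun x => (u x).abs) + X.posNorm g < δ := by
  rw [newtonNorm, ENNReal.add_iInf, iInf_lt_iff] at h
  obtain ⟨g, h⟩ := h
  by_cases hg : IsUpperGradient g u
  · refine ⟨g, hg, ?_⟩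
    simpa [hg, X.qnorm_eq_posNorm_abs hu, posNorm] using h
  · simp [hg] at h

theorem exists_of_capacity_lt {E : Set P} {δ : ℝ≥0∞} (h : X.capacity E < δ) :
    ∃ f g : P → ℝ≥0∞, Measurable f ∧ (∀ x ∈ E, 1 ≤ f x) ∧
      IsUpperGradient g (fun x => (f x : EReal)) ∧ X.posNorm f + X.posNorm g < δ := by
  simp only [capacity, iInf_lt_iff] at h
  obtain ⟨u, hu, huE, hlt⟩ := h
  obtain ⟨g, hg, hlt⟩ := X.exists_upperGradient_of_newtonNorm_lt hu hlt
  refine ⟨fun x => (u x).abs, g, EReal.measurable_abs.comp hu, fun x hx => ?_, hg.abs, hlt⟩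
  have h1 : (1 : EReal) ≤ max (u x) (-u x) := (huE x hx).trans (le_max_left _ _)
  have h2 := EReal.toENNReal_le_toENNReal h1
  rw [← EReal.abs_eq_toENNReal_max] at h2
  rwa [← EReal.coe_ennreal_one, EReal.toENNReal_coe] at h2

theorem capacity_le {E : Set P} {f g : P → ℝ≥0∞} (hf : Measurable f) (hfE : ∀ x ∈ E, 1 ≤ f x)
    (hg : IsUpperGradient g fun x => (f x : EReal)) :
    X.capacity E ≤ X.posNorm f + X.posNorm g := by
  refine iInf_le_of_le (fun x => (f x : EReal)) <| iInf_le_of_le hf.coe_ereal_ennreal <|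
    iInf_le_of_le (fun x hx => ?_) ?_
  · change ((1 : ℝ≥0∞) : EReal) ≤ f x
    exact EReal.coe_ennreal_le_coe_ennreal_iff.2 (hfE x hx)
  · exact add_le_add le_rfl (iInf₂_le g hg)

theorem capacity_mono {E F : Set P} (h : E ⊆ F) : X.capacity E ≤ X.capacity F :=
  iInf_mono fun _ => iInf_mono fun _ => iInf_mono' fun hF => ⟨fun x hx => hF x (h hx), le_rfl⟩

/-- Countable quasi-subadditivity of the capacity: the supremum of truncated admissible functions is
admissible for the union, and the sum of their upper gradients is an upper gradient of it. -/
theorem capacity_iUnion_le [OpensMeasurableSpace P] {E : ℕ → Set P} {δ : ℕ → ℝ≥0∞}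
    (h : ∀ n, X.capacity (E n) < δ n) :
    X.capacity (⋃ n, E n) ≤ ∑' n, (X.modulus : ℝ≥0∞) ^ (n + 1) * δ n := by
  choose f g hf hfE hg hlt using fun n => X.exists_of_capacity_lt (h n)
  have hgm : ∀ n, Measurable (g n) := fun n => (hg n).1.mono OpensMeasurableSpace.borel_le le_rfl
  set F : P → ℝ≥0∞ := fun x => ⨆ n, min (f n x) 1 with hF
  have hF1 : ∀ x, F x ≤ 1 := fun x => iSup_le fun n => min_le_right _ _
  have hFm : Measurable F := Measurable.iSup fun n => (hf n).min measurable_const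
  have key : ∀ {a b I J : ℝ≥0∞}, a ≤ b + I → I ≤ J → min a 1 ≤ min b 1 + J := by
    intro a b I J h1 h2
    rcases le_total b 1 with hb | hb
    · rw [min_eq_left hb]
      exact (min_le_left _ _).trans (h1.trans (by gcongr))
    · rw [min_eq_right hb]
      exact (min_le_right _ _).trans le_self_add
  have hG : IsUpperGradient (fun x => ∑' n, g n x) fun x => (F x : EReal) := by
    refine IsUpperGradient.of_le_add ?_ (fun x => ((hF1 x).trans_lt ENNReal.one_lt_top).ne) ?_
    · exact measurable_tsum_ennreal fun n => (hg n).1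
    · intro l γ hl hγ
      have hI : ∀ n, ∫⁻ t in Icc 0 l, g n (γ t) ≤ ∫⁻ t in Icc 0 l, ∑' n, g n (γ t) := fun n =>
        lintegral_mono fun t => ENNReal.le_tsum n
      constructor <;> refine iSup_le fun n => ?_
      · exact (key ((hg n).le_add hl hγ).1 (hI n)).trans
          (add_le_add (le_iSup (fun n => min (f n (γ l)) 1) n) le_rfl)
      · exact (key ((hg n).le_add hl hγ).2 (hI n)).trans
          (add_le_add (le_iSup (fun n => min (f n (γ 0)) 1) n) le_rfl)
  refine (X.capacity_le hFm ?_ hG).trans ?_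
  · intro x hx
    obtain ⟨n, hn⟩ := mem_iUnion.1 hx
    exact le_iSup_of_le n (le_min (hfE n x hn) le_rfl)
  · have h1 : X.posNorm F ≤ X.posNorm fun x => ∑' n, f n x :=
      X.posNorm_mono hFm (.tsum hf) fun x => iSup_le fun n =>
        (min_le_left _ _).trans (ENNReal.le_tsum n)
    refine (add_le_add (h1.trans (X.posNorm_tsum_le hf)) (X.posNorm_tsum_le hgm)).trans ?_
    rw [← ENNReal.tsum_add]
    refine ENNReal.tsum_le_tsum fun n => ?_
    rw [← mul_add]
    gcongr
    exact (hlt n).le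

/-- Chebyshev's inequality for the capacity. -/
theorem capacity_lt_abs_le [OpensMeasurableSpace P] {u : P → EReal} (hu : Measurable u)
    {a : ℝ≥0} (ha : a ≠ 0)
    {δ : ℝ≥0∞} (h : X.newtonNorm u < δ) :
    X.capacity {x | a < (u x).abs} ≤ ↑a⁻¹ * δ := by
  obtain ⟨g, hg, hlt⟩ := X.exists_upperGradient_of_newtonNorm_lt hu h
  have hum : Measurable fun x => (u x).abs := EReal.measurable_abs.comp hu
  have hgm : Measurable g := hg.1.mono OpensMeasurableSpace.borel_le le_rfl
  have haa : ((a⁻¹ : ℝ≥0) : ℝ≥0∞) * a = 1 := by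
    rw [← ENNReal.coe_mul, inv_mul_cancel₀ ha, ENNReal.coe_one]
  have hUG : IsUpperGradient (fun x => ((a⁻¹ : ℝ≥0) : ℝ≥0∞) * g x) fun x =>
      ((((a⁻¹ : ℝ≥0) : ℝ≥0∞) * (u x).abs : ℝ≥0∞) : EReal) := by
    refine ⟨Measurable.const_mul (m := borel P) hg.1 _, fun l γ hl hγ => ?_⟩
    have h1 := hg.abs.2 l γ hl hγ
    rw [lintegral_const_mul' _ _ ENNReal.coe_ne_top]
    rw [EReal.abs_coe_ennreal_sub_coe_ennreal_le_iff] at h1 ⊢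
    rcases h1 with h1 | ⟨h1, h2, h3, h4⟩
    · left
      rw [h1, ENNReal.mul_top]
      simpa using ha
    · refine Or.inr ⟨ENNReal.mul_ne_top ENNReal.coe_ne_top h1,
        ENNReal.mul_ne_top ENNReal.coe_ne_top h2, ?_, ?_⟩
      · rw [← mul_add]; gcongr
      · rw [← mul_add]; gcongr
  refine (X.capacity_le (hum.const_mul _) (fun x hx => ?_) hUG).trans ?_
  · rw [← haa]
    gcongr
    exact le_of_lt hx
  · rw [X.posNorm_const_mul _ hum, X.posNorm_const_mul _ hgm, ← mul_add]
    gcongr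

end QuasiBanachFunctionLattice

/-! ### Lower semicontinuous majorants -/

namespace QuasiBanachFunctionLattice

variable {P : Type*} [MetricSpace P] [MeasurableSpace P] {μ : Measure P}

theorem VitaliCaratheodory.exists_lowerSemicontinuous {X : QuasiBanachFunctionLattice μ}
    (hX : X.VitaliCaratheodory) {g : P → ℝ≥0∞} (hg : Measurable g) {δ : ℝ≥0∞}
    (hlt : X.posNorm g < δ) :
    ∃ ρ : P → ℝ≥0∞, LowerSemicontinuous ρ ∧ (∀ x, g x ≤ ρ x) ∧ X.posNorm ρ < δ := by
  rw [posNorm, hX _ hg.coe_ereal_ennreal] at hlt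
  simp only [iInf_lt_iff, EReal.abs_coe_ennreal] at hlt
  obtain ⟨v, hv, hgv, hlt⟩ := hlt
  have hv0 : ∀ x, 0 ≤ v x := fun x => (EReal.coe_ennreal_nonneg _).trans (hgv x)
  refine ⟨fun x => (v x).toENNReal, ?_, fun x => ?_, ?_⟩
  · exact EReal.continuous_toENNReal.comp_lowerSemicontinuous hv fun a b h =>
      EReal.toENNReal_le_toENNReal h
  · have := EReal.toENNReal_le_toENNReal (hgv x)
    rwa [EReal.toENNReal_coe] at this
  · simpa only [posNorm, EReal.coe_toENNReal (hv0 _)] using hlt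

/-- The quasi-norms of the characteristic functions tend to zero along a decreasing sequence of
measurable subsets of a bounded set with null intersection. -/
theorem BoundedSetsAbsCont.tendsto_posNorm_indicator {X : QuasiBanachFunctionLattice μ}
    (hX : X.BoundedSetsAbsCont) {B : Set P} (hB : MeasurableSet B) (hBb : Bornology.IsBounded B)
    {E : ℕ → Set P} (hE : ∀ n, MeasurableSet (E n)) (hEB : ∀ n, E n ⊆ B) (hanti : Antitone E)
    (h0 : μ (⋂ n, E n) = 0) :
    Tendsto (fun n => X.posNorm ((E n).indicator 1)) atTop (𝓝 0) := by
  have h := (hX B hB hBb).2 E hE hanti h0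
  refine h.congr fun n => ?_
  rw [posNorm]
  congr 1 with x
  by_cases hx : x ∈ E n
  · simp [hx, hEB n hx]
  · simp [hx]

/-- Outer regularity with respect to the quasi-norm: `A` is the intersection of decreasing open sets
up to a null set, and the absolute continuity of `χ_B` applies to the differences. -/
theorem BoundedSetsAbsCont.exists_isOpen_of_subset_ball [OpensMeasurableSpace P]
    {X : QuasiBanachFunctionLattice μ}
    (hX : X.BoundedSetsAbsCont) (hμ : IsBorelRegular μ) {x : P} {r : ℝ}
    (hball : μ (Metric.ball x r) < ∞) {A : Set P} (hA : MeasurableSet A)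
    (hAB : A ⊆ Metric.ball x r) {δ : ℝ≥0∞} (hδ : δ ≠ 0) :
    ∃ V, IsOpen V ∧ A ⊆ V ∧ X.posNorm ((V \ A).indicator 1) < δ := by
  have hBm : MeasurableSet (Metric.ball x r) := Metric.isOpen_ball.measurableSet
  have hAfin : μ A ≠ ∞ := ((measure_mono hAB).trans_lt hball).ne
  obtain ⟨D, hD, hAD, hμD⟩ := hμ A hA
  -- outer regularity of the restriction of `μ` to the Borel sets of the ball
  have hopen : ∀ n : ℕ, ∃ V, IsOpen V ∧ A ⊆ V ∧ V ⊆ Metric.ball x r ∧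
      μ (V \ A) ≤ ((n : ℝ≥0∞) + 1)⁻¹ := by
    intro n
    have hle : borel P ≤ ‹MeasurableSpace P› := OpensMeasurableSpace.borel_le
    have : @BorelSpace P _ (borel P) := @BorelSpace.mk P _ (borel P) rfl
    let ν : @Measure P (borel P) := (μ.restrict (Metric.ball x r)).trim hle
    have hνapp : ∀ S, MeasurableSet[borel P] S → ν S = μ (S ∩ Metric.ball x r) := fun S hS => by
      rw [trim_measurableSet_eq hle hS, Measure.restrict_apply (hle _ hS)]
    have : @IsFiniteMeasure P (borel P) ν := by
      refine @IsFiniteMeasure.mk P (borel P) ν ?_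
      rw [hνapp _ (@MeasurableSet.univ P (borel P)), univ_inter]
      exact hball
    have : @Measure.OuterRegular P (borel P) _ ν := inferInstance
    have hε : ((n : ℝ≥0∞) + 1)⁻¹ ≠ 0 := by simp
    have hνD : ν D ≤ μ A := by
      rw [hνapp D hD, ← hμD]
      exact measure_mono inter_subset_left
    obtain ⟨V, hDV, hV, hlt⟩ := @Set.exists_isOpen_lt_add P (borel P) ν _ this D
      (hνD.trans_lt hAfin.lt_top).ne _ hε
    refine ⟨V ∩ Metric.ball x r, hV.inter Metric.isOpen_ball,
      subset_inter (hAD.trans hDV) hAB, inter_subset_right, ?_⟩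
    rw [measure_sdiff (subset_inter (hAD.trans hDV) hAB) hA.nullMeasurableSet hAfin,
      ← hνapp V (MeasurableSpace.measurableSet_generateFrom hV)]
    exact tsub_le_iff_left.2 (hlt.le.trans (by gcongr))
  choose V hV hAV hVB hVμ using hopen
  set W : ℕ → Set P := fun n => ⋂ k ∈ Finset.range (n + 1), V k with hW
  have hWo : ∀ n, IsOpen (W n) := fun n => isOpen_biInter_finset fun k _ => hV k
  have hAW : ∀ n, A ⊆ W n := fun n => subset_iInter₂ fun k _ => hAV k
  have hWV : ∀ n, W n ⊆ V n := fun n => biInter_subset_of_mem (by simp)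
  have hWanti : Antitone W := by
    intro m n hmn
    refine biInter_subset_biInter_left fun k hk => ?_
    simp only [Finset.coe_range, mem_Iio] at hk ⊢
    omega
  have hlim := hX.tendsto_posNorm_indicator hBm Metric.isBounded_ball
    (E := fun n => W n \ A) (fun n => (hWo n).measurableSet.diff hA)
    (fun n => sdiff_subset.trans ((hWV n).trans (hVB n)))
    (fun m n hmn => sdiff_subset_sdiff_left (hWanti hmn)) (by
      refine le_antisymm ?_ zero_le
      refine ge_of_tendsto' (x := atTop) (f := fun n : ℕ => ((n : ℝ≥0∞) + 1)⁻¹) ?_ fun n => ?_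
      · have := (ENNReal.tendsto_inv_nat_nhds_zero).comp (tendsto_add_atTop_nat 1)
        refine this.congr fun n => ?_
        simp
      · exact (measure_mono ((iInter_subset _ n).trans (sdiff_subset_sdiff_left (hWV n)))).trans
          (hVμ n))
  obtain ⟨n, hn⟩ := (hlim.eventually (gt_mem_nhds (pos_iff_ne_zero.2 hδ))).exists
  exact ⟨W n, hWo n, hAW n, hn⟩

theorem BoundedSetsAbsCont.exists_isOpen [OpensMeasurableSpace P]
    {X : QuasiBanachFunctionLattice μ}
    (hX : X.BoundedSetsAbsCont) (hμ : IsBorelRegular μ)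
    (hball : ∀ (x : P) (r : ℝ), μ (Metric.ball x r) < ∞) {A : Set P} (hA : MeasurableSet A)
    {ε : ℝ≥0∞} (hε : ε ≠ 0) :
    ∃ V, IsOpen V ∧ A ⊆ V ∧ X.posNorm ((V \ A).indicator 1) < ε := by
  rcases A.eq_empty_or_nonempty with rfl | ⟨x, -⟩
  · refine ⟨∅, isOpen_empty, subset_rfl, ?_⟩
    have : X.posNorm ((∅ \ ∅ : Set P).indicator 1) = 0 := by
      rw [X.posNorm_eq_zero_iff (measurable_one.indicator (by simp))]
      simp
    rw [this]
    exact pos_iff_ne_zero.2 hε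
  obtain ⟨δ, hδ, hsum⟩ := X.exists_pos_tsum_modulus_lt hε
  have hAn : ∀ n : ℕ, MeasurableSet (A ∩ Metric.ball x n) := fun n =>
    hA.inter Metric.isOpen_ball.measurableSet
  choose V hV hAV hlt using fun n : ℕ =>
    hX.exists_isOpen_of_subset_ball hμ (hball x n) (hAn n) inter_subset_right (hδ n)
  have hm : ∀ n, Measurable ((V n \ (A ∩ Metric.ball x n)).indicator (1 : P → ℝ≥0∞)) := fun n =>
    measurable_one.indicator ((hV n).measurableSet.diff (hAn n))
  refine ⟨⋃ n, V n, isOpen_iUnion hV, fun y hy => ?_, ?_⟩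
  · obtain ⟨n, hn⟩ := exists_nat_gt (dist y x)
    exact mem_iUnion.2 ⟨n, hAV n ⟨hy, hn⟩⟩
  refine lt_of_le_of_lt ?_ hsum
  refine le_trans (X.posNorm_mono (measurable_one.indicator
    ((isOpen_iUnion hV).measurableSet.diff hA)) (measurable_tsum_ennreal hm) fun y => ?_)
    ((X.posNorm_tsum_le hm).trans (ENNReal.tsum_le_tsum fun n => by gcongr; exact (hlt n).le))
  by_cases hy : y ∈ (⋃ n, V n) \ A
  swap
  · rw [indicator_of_notMem hy]; exact zero_le
  rw [indicator_of_mem hy]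
  obtain ⟨n, hn⟩ := mem_iUnion.1 hy.1
  refine le_trans ?_ (ENNReal.le_tsum
    (f := fun n => (V n \ (A ∩ Metric.ball x n)).indicator (1 : P → ℝ≥0∞) y) n)
  rw [indicator_of_mem (show y ∈ V n \ (A ∩ Metric.ball x n) from ⟨hn, fun h => hy.2 h.1⟩)]

theorem BoundedSetsAbsCont.exists_lowerSemicontinuous_simpleFunc [OpensMeasurableSpace P]
    {X : QuasiBanachFunctionLattice μ}
    (hX : X.BoundedSetsAbsCont) (hμ : IsBorelRegular μ)
    (hball : ∀ (x : P) (r : ℝ), μ (Metric.ball x r) < ∞) (f : SimpleFunc P ℝ≥0) {ε : ℝ≥0∞}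
    (hε : ε ≠ 0) :
    ∃ ρ e : P → ℝ≥0∞, LowerSemicontinuous ρ ∧ Measurable e ∧ (∀ x, f x ≤ ρ x) ∧
      (∀ x, ρ x ≤ f x + e x) ∧ X.posNorm e < ε := by
  induction f using SimpleFunc.induction generalizing ε with
  | @const c s hs =>
    have hε' : ((c : ℝ≥0∞) + 1)⁻¹ * ε ≠ 0 := by simp [hε]
    obtain ⟨V, hV, hsV, hlt⟩ := hX.exists_isOpen hμ hball hs hε'
    have hχ : Measurable ((V \ s).indicator (1 : P → ℝ≥0∞)) :=
      measurable_one.indicator (hV.measurableSet.diff hs)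
    refine ⟨V.indicator fun _ => (c : ℝ≥0∞), fun x => c * (V \ s).indicator 1 x,
      hV.lowerSemicontinuous_indicator zero_le, hχ.const_mul _, fun x => ?_, fun x => ?_, ?_⟩
    · by_cases hx : x ∈ s
      · simp [hx, hsV hx]
      · simp [hx]
    · by_cases hxV : x ∈ V
      · by_cases hx : x ∈ s
        · simp [hx, hxV]
        · simp [hx, hxV]
      · simp [hxV]
    · rw [X.posNorm_const_mul c hχ]
      have h1 : ((c : ℝ≥0∞) + 1) * (((c : ℝ≥0∞) + 1)⁻¹ * ε) = ε := by
        rw [← mul_assoc, ENNReal.mul_inv_cancel (by simp) (by simp), one_mul]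
      calc (c : ℝ≥0∞) * X.posNorm ((V \ s).indicator 1)
          ≤ ((c : ℝ≥0∞) + 1) * X.posNorm ((V \ s).indicator 1) := by gcongr; exact le_self_add
        _ < ((c : ℝ≥0∞) + 1) * (((c : ℝ≥0∞) + 1)⁻¹ * ε) :=
            (ENNReal.mul_lt_mul_iff_right (by simp) (by simp)).2 hlt
        _ = ε := h1
  | @add f₁ f₂ _ h₁ h₂ =>
    have hc0 : (X.modulus : ℝ≥0∞) ≠ 0 := (zero_lt_one.trans_le X.one_le_modulus').ne'
    have hε' : (X.modulus : ℝ≥0∞)⁻¹ * (ε / 2) ≠ 0 := by simp [hε]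
    obtain ⟨ρ₁, e₁, hρ₁, he₁, hfρ₁, hρf₁, hlt₁⟩ := h₁ hε'
    obtain ⟨ρ₂, e₂, hρ₂, he₂, hfρ₂, hρf₂, hlt₂⟩ := h₂ hε'
    refine ⟨fun x => ρ₁ x + ρ₂ x, fun x => e₁ x + e₂ x, hρ₁.add hρ₂, he₁.add he₂, fun x => ?_,
      fun x => ?_, ?_⟩
    · simpa using add_le_add (hfρ₁ x) (hfρ₂ x)
    · refine (add_le_add (hρf₁ x) (hρf₂ x)).trans_eq ?_
      simp only [SimpleFunc.coe_add, Pi.add_apply, ENNReal.coe_add]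
      ring
    · refine (X.posNorm_add_le he₁ he₂).trans_lt ?_
      have h1 : (X.modulus : ℝ≥0∞) * ((X.modulus : ℝ≥0∞)⁻¹ * (ε / 2) +
          (X.modulus : ℝ≥0∞)⁻¹ * (ε / 2)) = ε := by
        rw [← mul_add, ENNReal.add_halves, ← mul_assoc,
          ENNReal.mul_inv_cancel hc0 ENNReal.coe_ne_top, one_mul]
      calc (X.modulus : ℝ≥0∞) * (X.posNorm e₁ + X.posNorm e₂)
          < X.modulus * ((X.modulus : ℝ≥0∞)⁻¹ * (ε / 2) + (X.modulus : ℝ≥0∞)⁻¹ * (ε / 2)) :=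
            (ENNReal.mul_lt_mul_iff_right hc0 ENNReal.coe_ne_top).2 (ENNReal.add_lt_add hlt₁ hlt₂)
        _ = ε := h1

/-- The Vitali–Carathéodory argument: approximate each summand of a decomposition of `g` into simple
functions from above. -/
theorem BoundedSetsAbsCont.exists_lowerSemicontinuous [OpensMeasurableSpace P]
    {X : QuasiBanachFunctionLattice μ} (hX : X.BoundedSetsAbsCont) (hμ : IsBorelRegular μ)
    (hball : ∀ (x : P) (r : ℝ), μ (Metric.ball x r) < ∞) {g : P → ℝ≥0∞} (hg : Measurable g)
    {δ : ℝ≥0∞} (hlt : X.modulus * X.posNorm g < δ) :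
    ∃ ρ : P → ℝ≥0∞, LowerSemicontinuous ρ ∧ (∀ x, g x ≤ ρ x) ∧ X.posNorm ρ < δ := by
  have hc0 : (X.modulus : ℝ≥0∞) ≠ 0 := (zero_lt_one.trans_le X.one_le_modulus').ne'
  have hη : (X.modulus : ℝ≥0∞)⁻¹ * (δ - X.modulus * X.posNorm g) ≠ 0 := by
    simp [tsub_eq_zero_iff_le, hlt]
  obtain ⟨η, hη0, hsum⟩ := X.exists_pos_tsum_modulus_lt hη
  choose ρ e hρ he hfρ hρf hlte using fun n =>
    hX.exists_lowerSemicontinuous_simpleFunc hμ hball (SimpleFunc.eapproxDiff g n) (hη0 n)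
  refine ⟨fun x => ∑' n, ρ n x, lowerSemicontinuous_tsum hρ, fun x => ?_, ?_⟩
  · rw [← SimpleFunc.tsum_eapproxDiff g hg]
    exact ENNReal.tsum_le_tsum fun n => hfρ n x
  have hem : Measurable fun x => ∑' n, e n x := measurable_tsum_ennreal he
  have h1 : X.posNorm (fun x => ∑' n, ρ n x) ≤ X.posNorm fun x => g x + ∑' n, e n x := by
    refine X.posNorm_mono (measurable_tsum_ennreal fun n => (hρ n).measurable) (hg.add hem)
      fun x => ?_
    rw [← SimpleFunc.tsum_eapproxDiff g hg, ← ENNReal.tsum_add]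
    exact ENNReal.tsum_le_tsum fun n => hρf n x
  have h2 : X.posNorm (fun x => ∑' n, e n x) <
      (X.modulus : ℝ≥0∞)⁻¹ * (δ - X.modulus * X.posNorm g) :=
    ((X.posNorm_tsum_le he).trans (ENNReal.tsum_le_tsum fun n => by
      gcongr; exact (hlte n).le)).trans_lt hsum
  refine (h1.trans (X.posNorm_add_le hg hem)).trans_lt ?_
  calc (X.modulus : ℝ≥0∞) * (X.posNorm g + X.posNorm fun x => ∑' n, e n x)
      = X.modulus * X.posNorm g + X.modulus * X.posNorm (fun x => ∑' n, e n x) := mul_add _ _ _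
    _ < X.modulus * X.posNorm g +
        X.modulus * ((X.modulus : ℝ≥0∞)⁻¹ * (δ - X.modulus * X.posNorm g)) :=
        ENNReal.add_lt_add_left (ne_top_of_lt hlt)
          ((ENNReal.mul_lt_mul_iff_right hc0 ENNReal.coe_ne_top).2 h2)
    _ = δ := by
        rw [← mul_assoc, ENNReal.mul_inv_cancel hc0 ENNReal.coe_ne_top, one_mul,
          add_tsub_cancel_of_le hlt.le]

/-- Under either hypothesis on the space, measurable functions of small quasi-norm have lower
semicontinuous majorants of small quasi-norm. -/
theorem exists_lowerSemicontinuous_ge [OpensMeasurableSpace P] {X : QuasiBanachFunctionLattice μ}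
    (hX : X.VitaliCaratheodory ∨ X.BoundedSetsAbsCont) (hμ : IsBorelRegular μ)
    (hball : ∀ (x : P) (r : ℝ), μ (Metric.ball x r) < ∞) {g : P → ℝ≥0∞} (hg : Measurable g)
    {δ : ℝ≥0∞} (hlt : X.modulus * X.posNorm g < δ) :
    ∃ ρ : P → ℝ≥0∞, LowerSemicontinuous ρ ∧ (∀ x, g x ≤ ρ x) ∧ X.posNorm ρ < δ := by
  rcases hX with hX | hX
  · refine hX.exists_lowerSemicontinuous hg (lt_of_le_of_lt ?_ hlt)
    exact le_mul_of_one_le_left zero_le X.one_le_modulus'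
  · exact hX.exists_lowerSemicontinuous hμ hball hg hlt

end QuasiBanachFunctionLattice

/-! ### Sets of capacity zero -/

namespace QuasiBanachFunctionLattice

variable {P : Type*} [MetricSpace P] [MeasurableSpace P] [OpensMeasurableSpace P] {μ : Measure P}

/-- For a set of capacity zero there is a Borel function of small quasi-norm that is infinite on the
set and whose integral along every nonconstant curve starting in the set is infinite. -/
theorem exists_lintegral_eq_top_of_capacity_eq_zero (X : QuasiBanachFunctionLattice μ)
    (hμ : IsBorelRegular μ) {E : Set P} (hE : X.capacity E = 0) {ε : ℝ≥0∞} (hε : ε ≠ 0) :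
    ∃ g : P → ℝ≥0∞, Measurable g ∧ X.posNorm g < ε ∧ (∀ x ∈ E, g x = ∞) ∧
      ∀ (γ : ℝ → P) (l : ℝ), 0 < l → LipschitzWith 1 γ → γ 0 ∈ E →
        ∫⁻ t in Icc 0 l, g (γ t) = ∞ := by
  have hc0 : (X.modulus : ℝ≥0∞) ≠ 0 := (zero_lt_one.trans_le X.one_le_modulus').ne'
  obtain ⟨δ, hδ, hsum⟩ := X.exists_pos_tsum_modulus_lt (ε := min 1 ((X.modulus : ℝ≥0∞)⁻¹ * ε))
    (by simp [hε])
  have hcap : ∀ n, X.capacity E < δ n := fun n => by rw [hE]; exact pos_iff_ne_zero.2 (hδ n)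
  choose w g hw hwE hg hlt using fun n => X.exists_of_capacity_lt (hcap n)
  have hgm : ∀ n, Measurable (g n) := fun n => (hg n).1.mono OpensMeasurableSpace.borel_le le_rfl
  have hwm : Measurable fun x => ∑' n, w n x := measurable_tsum_ennreal hw
  have hGm : Measurable fun x => ∑' n, g n x := measurable_tsum_ennreal hgm
  have hwfin : X.posNorm (fun x => ∑' n, w n x) < 1 :=
    ((X.posNorm_tsum_le hw).trans (ENNReal.tsum_le_tsum fun n => by
      have := le_self_add.trans (hlt n).le
      gcongr)).trans_lt (hsum.trans_le (min_le_left _ _))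
  have hGlt : X.posNorm (fun x => ∑' n, g n x) < (X.modulus : ℝ≥0∞)⁻¹ * ε :=
    ((X.posNorm_tsum_le hgm).trans (ENNReal.tsum_le_tsum fun n => by
      have := le_add_self.trans (hlt n).le
      gcongr)).trans_lt (hsum.trans_le (min_le_right _ _))
  obtain ⟨D, hD, hwD, hμD⟩ := hμ {x | ∑' n, w n x = ∞} (hwm (measurableSet_singleton ∞))
  rw [X.measure_eq_top_eq_zero hwm (hwfin.trans ENNReal.one_lt_top).ne] at hμD
  have hDm : MeasurableSet D := OpensMeasurableSpace.borel_le _ hD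
  have hED : E ⊆ D := fun x hx => hwD (by
    have : ∑' _ : ℕ, (1 : ℝ≥0∞) ≤ ∑' n, w n x := ENNReal.tsum_le_tsum fun n => hwE n x hx
    simpa using this)
  set χ : P → ℝ≥0∞ := D.indicator fun _ => ∞ with hχ
  have hχm : Measurable χ := measurable_const.indicator hDm
  have hχ0 : X.posNorm χ = 0 := by
    rw [X.posNorm_eq_zero_iff hχm]
    refine measure_mono_null (fun x hx => ?_) hμD
    by_contra hxD
    exact hx (indicator_of_notMem hxD _)
  refine ⟨fun x => (∑' n, g n x) + χ x, hGm.add hχm, ?_, fun x hx => ?_, ?_⟩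
  · refine (X.posNorm_add_le hGm hχm).trans_lt ?_
    rw [hχ0, add_zero]
    calc (X.modulus : ℝ≥0∞) * X.posNorm (fun x => ∑' n, g n x)
        < X.modulus * ((X.modulus : ℝ≥0∞)⁻¹ * ε) :=
          (ENNReal.mul_lt_mul_iff_right hc0 ENNReal.coe_ne_top).2 hGlt
      _ = ε := by rw [← mul_assoc, ENNReal.mul_inv_cancel hc0 ENNReal.coe_ne_top, one_mul]
  · simp [hχ, hED hx]
  · intro γ l hl hγ h0
    have hpre : MeasurableSet (γ ⁻¹' D) := by
      have hm : @Measurable ℝ P _ (borel P) γ := by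
        let _ : MeasurableSpace P := borel P
        have : BorelSpace P := ⟨rfl⟩
        exact hγ.continuous.measurable
      exact hm hD
    by_cases hnull : volume (γ ⁻¹' D ∩ Icc 0 l) = 0
    swap
    · -- the curve spends a positive time in the null set `D`, where the function is infinite
      refine top_le_iff.1 ?_
      calc ∞ = ∫⁻ _ in γ ⁻¹' D ∩ Icc 0 l, (∞ : ℝ≥0∞) := by
            rw [setLIntegral_const, ENNReal.top_mul hnull]
        _ ≤ ∫⁻ t in γ ⁻¹' D ∩ Icc 0 l, (∑' n, g n (γ t)) + χ (γ t) :=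
            setLIntegral_mono' (hpre.inter measurableSet_Icc) fun t ht => by
              simp [hχ, show γ t ∈ D from ht.1]
        _ ≤ _ := lintegral_mono_set inter_subset_right
    · -- otherwise some point of the curve lies off `D`, and each `g n` has to account for the
      -- difference between the values of `w n` at the endpoints
      obtain ⟨t, ht, htD⟩ : ∃ t ∈ Icc 0 l, γ t ∉ D := by
        by_contra! h
        rw [inter_eq_right.2 (show Icc 0 l ⊆ γ ⁻¹' D from h), Real.volume_Icc, sub_zero,
          ENNReal.ofReal_eq_zero] at hnull
        exact hl.not_ge hnull
      have hne : γ 0 ≠ γ t := fun h => htD (h ▸ hED h0)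
      have hwt : ∑' n, w n (γ t) ≠ ∞ := fun h => htD (hwD h)
      have hsumle : ∑' n, w n (γ 0) ≤ ∑' n, w n (γ t) +
          ∑' n, ∫⁻ s in Icc 0 t, g n (γ s) := by
        rw [← ENNReal.tsum_add]
        refine ENNReal.tsum_le_tsum fun n => ?_
        rcases EReal.abs_coe_ennreal_sub_coe_ennreal_le_iff.1
          ((hg n).abs_sub_le_lintegral hγ ht.1 hne) with h | h
        · simp [h]
        · exact h.2.2.1
      have htop : ∑' n, w n (γ 0) = ∞ := by
        have : ∑' _ : ℕ, (1 : ℝ≥0∞) ≤ ∑' n, w n (γ 0) :=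
          ENNReal.tsum_le_tsum fun n => hwE n _ h0
        simpa using this
      rw [htop, top_le_iff, ENNReal.add_eq_top, or_iff_right hwt] at hsumle
      refine top_le_iff.1 (hsumle.symm.le.trans ((tsum_lintegral_le_lintegral_tsum _ _).trans ?_))
      exact (lintegral_mono_set (Icc_subset_Icc_right ht.2)).trans
        (lintegral_mono fun s => le_self_add)

/-- A set of capacity zero inside a relatively compact open set `W` has open neighbourhoods of small
capacity. The neighbourhood is a superlevel set of the distance to the complement of `V ∩ W`
measured with a lower semicontinuous density `ρ` of small quasi-norm, where `V = {ρ > 1}`. -/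
theorem exists_isOpen_capacity_lt_of_subset_isCompact {X : QuasiBanachFunctionLattice μ}
    (hX : X.VitaliCaratheodory ∨ X.BoundedSetsAbsCont) (hμ : IsBorelRegular μ)
    (hball : ∀ (x : P) (r : ℝ), μ (Metric.ball x r) < ∞) {E W K : Set P}
    (hE : X.capacity E = 0) (hEW : E ⊆ W) (hW : IsOpen W) (hWK : W ⊆ K) (hK : IsCompact K)
    {ε : ℝ≥0∞} (hε : ε ≠ 0) : ∃ U, IsOpen U ∧ E ⊆ U ∧ X.capacity U < ε := by
  have hc0 : (X.modulus : ℝ≥0∞) ≠ 0 := (zero_lt_one.trans_le X.one_le_modulus').ne'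
  obtain ⟨g, hg, hglt, hgE, hgγ⟩ := X.exists_lintegral_eq_top_of_capacity_eq_zero hμ hE
    (ε := (X.modulus : ℝ≥0∞)⁻¹ * (4⁻¹ * ε)) (by simp [hε])
  obtain ⟨ρ, hρ, hgρ, hρlt⟩ := exists_lowerSemicontinuous_ge hX hμ hball hg (δ := 4⁻¹ * ε) (by
    calc (X.modulus : ℝ≥0∞) * X.posNorm g
        < X.modulus * ((X.modulus : ℝ≥0∞)⁻¹ * (4⁻¹ * ε)) :=
          (ENNReal.mul_lt_mul_iff_right hc0 ENNReal.coe_ne_top).2 hglt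
      _ = 4⁻¹ * ε := by
          rw [← mul_assoc, ENNReal.mul_inv_cancel hc0 ENNReal.coe_ne_top, one_mul])
  have hρm : Measurable ρ := hρ.measurable
  have hρb : Measurable[borel P] ρ := by
    let _ : MeasurableSpace P := borel P
    have : BorelSpace P := ⟨rfl⟩
    exact hρ.measurable
  set F : Set P := ({x | 1 < ρ x} ∩ W)ᶜ with hFdef
  have hF : IsClosed F := ((hρ.isOpen_preimage 1).inter hW).isClosed_compl
  have hFc : ∀ x ∉ F, 1 < ρ x ∧ x ∈ W := fun x hx => not_not.1 hx
  have hlsc : LowerSemicontinuous (curveDist ρ F) :=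
    lowerSemicontinuous_curveDist hK hF (fun x hx => hWK (hFc x hx).2)
      (fun x hx => (hFc x hx).1.le) hρ
  have hEF : ∀ x ∈ E, x ∉ F := fun x hx => not_not.2
    ⟨lt_of_lt_of_le (by rw [hgE x hx]; exact ENNReal.one_lt_top) (hgρ x), hEW hx⟩
  have hEtop : ∀ x ∈ E, curveDist ρ F x = ∞ := by
    intro x hx
    by_contra hne
    obtain ⟨γ, l, hl, hγ, hγ0, hγl, hint⟩ := exists_curve_of_curveDist_lt (lt_top_iff_ne_top.2 hne)
    have hl0 : 0 < l := hl.lt_of_ne fun h => hEF x hx (by rw [← hγ0, h]; exact hγl)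
    refine hint.ne (top_le_iff.1 ?_)
    rw [← hgγ γ l hl0 hγ (hγ0 ▸ hx)]
    exact lintegral_mono fun t => hgρ _
  have hcm : Measurable (curveDist ρ F) := hlsc.measurable
  set u : P → ℝ≥0∞ := fun x => min 1 (curveDist ρ F x) with hu
  have hum : Measurable u := measurable_const.min hcm
  have hUG : IsUpperGradient ρ fun x => (u x : EReal) := by
    refine IsUpperGradient.of_le_add hρb
      (fun x => ((min_le_left _ _).trans_lt ENNReal.one_lt_top).ne) fun l γ hl hγ => ?_
    have hlip := hγ.lipschitzOnWith.lipschitzWith_comp_projIcc hl.le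
    have heq : ∀ t ∈ Icc 0 l, γ (projIcc 0 l hl.le t) = γ t := fun t ht => by
      rw [projIcc_of_mem hl.le ht]
    have hint : ∫⁻ t in Icc 0 l, ρ (γ (projIcc 0 l hl.le t)) = ∫⁻ t in Icc 0 l, ρ (γ t) :=
      setLIntegral_congr_fun measurableSet_Icc fun t ht => congrArg ρ (heq t ht)
    have key : ∀ {a b I : ℝ≥0∞}, a ≤ b + I → min 1 a ≤ min 1 b + I := by
      intro a b I h
      rcases le_total 1 b with hb | hb
      · rw [min_eq_left hb]; exact (min_le_left _ _).trans le_self_add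
      · rw [min_eq_right hb]; exact (min_le_right _ _).trans h
    have h1 := curveDist_le_add (ρ := ρ) (F := F) hl.le hlip
    have h2 := curveDist_le_add' (ρ := ρ) (F := F) hl.le hlip
    simp only [hint] at h1 h2
    rw [heq 0 (left_mem_Icc.2 hl.le), heq l (right_mem_Icc.2 hl.le)] at h1 h2
    exact ⟨key h1, key h2⟩
  have huρ : ∀ x, u x ≤ ρ x := by
    intro x
    by_cases hx : x ∈ F
    · simp only [hu, curveDist_eq_zero hx, zero_le, inf_of_le_right]
    · exact (min_le_left _ _).trans (hFc x hx).1.le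
  have hnewton : X.newtonNorm (fun x => (u x : EReal)) ≤ X.posNorm ρ + X.posNorm ρ :=
    add_le_add (X.posNorm_mono hum hρm huρ) (iInf₂_le ρ hUG)
  have hsum : X.posNorm ρ + X.posNorm ρ < 4⁻¹ * ε + 4⁻¹ * ε := ENNReal.add_lt_add hρlt hρlt
  obtain ⟨δ, hδ, hδlt⟩ := exists_between (hnewton.trans_lt hsum)
  have hcap := X.capacity_lt_abs_le hum.coe_ereal_ennreal (a := 2⁻¹) (by simp) hδ
  simp only [EReal.abs_coe_ennreal, inv_inv] at hcap
  refine ⟨{x | ((2⁻¹ : ℝ≥0) : ℝ≥0∞) < u x}, ?_, fun x hx => ?_, hcap.trans_lt ?_⟩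
  · exact ((lowerSemicontinuous_const (z := (1 : ℝ≥0∞))).inf hlsc).isOpen_preimage _
  · have : u x = 1 := by simp [hu, hEtop x hx]
    rw [mem_ofPred_eq, this]
    exact_mod_cast (by norm_num : (2⁻¹ : ℝ≥0) < 1)
  · calc ((2 : ℝ≥0) : ℝ≥0∞) * δ < (2 : ℝ≥0) * (4⁻¹ * ε + 4⁻¹ * ε) :=
          (ENNReal.mul_lt_mul_iff_right (by simp) ENNReal.coe_ne_top).2 hδlt
      _ = (4 * 4⁻¹) * ε := by push_cast; ring
      _ = ε := by rw [ENNReal.mul_inv_cancel (by simp) (by simp), one_mul]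

/-- Sets of capacity zero have open neighbourhoods of arbitrarily small capacity. -/
theorem exists_isOpen_capacity_lt_of_capacity_eq_zero [LocallyCompactSpace P]
    [SecondCountableTopology P] {X : QuasiBanachFunctionLattice μ}
    (hX : X.VitaliCaratheodory ∨ X.BoundedSetsAbsCont) (hμ : IsBorelRegular μ)
    (hball : ∀ (x : P) (r : ℝ), μ (Metric.ball x r) < ∞) {E : Set P}
    (hE : X.capacity E = 0) {ε : ℝ≥0∞} (hε : ε ≠ 0) :
    ∃ U, IsOpen U ∧ E ⊆ U ∧ X.capacity U < ε := by
  obtain ⟨δ, hδ, hsum⟩ := X.exists_pos_tsum_modulus_lt hε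
  let K := CompactExhaustion.choice P
  have hex : ∀ n, ∃ U, IsOpen U ∧ E ∩ interior (K n) ⊆ U ∧ X.capacity U < δ n := fun n =>
    exists_isOpen_capacity_lt_of_subset_isCompact hX hμ hball
      (le_antisymm ((X.capacity_mono inter_subset_left).trans hE.le) zero_le)
      inter_subset_right isOpen_interior interior_subset (K.isCompact n) (hδ n)
  choose U hU hEU hcap using hex
  refine ⟨⋃ n, U n, isOpen_iUnion hU, fun x hx => ?_, (X.capacity_iUnion_le hcap).trans_lt hsum⟩
  obtain ⟨n, hn⟩ := mem_iUnion.1 (K.iUnion_eq ▸ mem_univ x)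
  exact mem_iUnion.2 ⟨n + 1, hEU _ ⟨hx, K.subset_interior_succ n hn⟩⟩

/-- Countable subadditivity for sets whose capacities decay geometrically. -/
theorem capacity_iUnion_add_le (X : QuasiBanachFunctionLattice μ) {H : ℕ → Set P}
    (hH : ∀ n, X.capacity (H n) < ((X.modulus : ℝ≥0∞) ^ (n + 2))⁻¹ * 2⁻¹ ^ n) (m : ℕ)
    {O : Set P} {δ : ℝ≥0∞} (hO : X.capacity O < δ) :
    X.capacity (O ∪ ⋃ n, H (m + n)) ≤ X.modulus * δ + 2⁻¹ ^ m * 2 := by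
  have hc1 := X.one_le_modulus'
  have hc0 : (X.modulus : ℝ≥0∞) ≠ 0 := (zero_lt_one.trans_le hc1).ne'
  -- `O` takes index `0` in the countable union, which shifts the remaining exponents by one
  let G : ℕ → Set P := fun n => Nat.casesOn n O fun k => H (m + k)
  let η : ℕ → ℝ≥0∞ := fun n => Nat.casesOn n δ fun k =>
    ((X.modulus : ℝ≥0∞) ^ (m + k + 2))⁻¹ * 2⁻¹ ^ (m + k)
  have hG : ∀ n, X.capacity (G n) < η n := by
    rintro (_ | k)
    · exact hO
    · exact hH (m + k)
  have hsub : O ∪ ⋃ n, H (m + n) ⊆ ⋃ n, G n :=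
    union_subset (subset_iUnion G 0) (iUnion_subset fun n => subset_iUnion G (n + 1))
  refine (X.capacity_mono hsub).trans ((X.capacity_iUnion_le hG).trans ?_)
  rw [tsum_eq_zero_add' ENNReal.summable]
  refine add_le_add (by simp [η]) ?_
  have hgeom : ∑' k : ℕ, (2⁻¹ : ℝ≥0∞) ^ m * 2⁻¹ ^ k = 2⁻¹ ^ m * 2 := by
    rw [ENNReal.tsum_mul_left, ENNReal.tsum_geometric, ENNReal.one_sub_inv_two, inv_inv]
  rw [← hgeom]
  refine ENNReal.tsum_le_tsum fun k => ?_
  calc (X.modulus : ℝ≥0∞) ^ (k + 1 + 1) * (((X.modulus : ℝ≥0∞) ^ (m + k + 2))⁻¹ * 2⁻¹ ^ (m + k))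
      ≤ (X.modulus : ℝ≥0∞) ^ (m + k + 2) *
        (((X.modulus : ℝ≥0∞) ^ (m + k + 2))⁻¹ * 2⁻¹ ^ (m + k)) := by
        gcongr ?_ * _
        exact pow_le_pow_right₀ hc1 (by omega)
    _ = 2⁻¹ ^ (m + k) := by
        rw [← mul_assoc, ENNReal.mul_inv_cancel (pow_ne_zero _ hc0)
          (ENNReal.pow_ne_top ENNReal.coe_ne_top), one_mul]
    _ = 2⁻¹ ^ m * 2⁻¹ ^ k := pow_add _ _ _

end QuasiBanachFunctionLattice

/-! ### Quasi-continuity -/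

namespace QuasiBanachFunctionLattice

variable {P : Type*} [MetricSpace P] [MeasurableSpace P] {μ : Measure P}

theorem capacity_empty (X : QuasiBanachFunctionLattice μ) : X.capacity (∅ : Set P) = 0 := by
  have h0 : X.posNorm (fun _ : P => (0 : ℝ≥0∞)) = 0 := by
    rw [X.posNorm_eq_zero_iff measurable_const]
    simp
  have hg : IsUpperGradient (fun _ : P => (0 : ℝ≥0∞)) fun _ => ((0 : ℝ≥0∞) : EReal) :=
    IsUpperGradient.of_le_add measurable_const (by simp) (by simp)
  have := X.capacity_le measurable_const (E := ∅) (by simp) hg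
  rw [h0, add_zero] at this
  exact le_antisymm this zero_le

/-- A Borel–Cantelli lemma for the capacity. -/
theorem capacity_iInter_iUnion_eq_zero [OpensMeasurableSpace P]
    (X : QuasiBanachFunctionLattice μ) {H : ℕ → Set P}
    (hH : ∀ n, X.capacity (H n) < ((X.modulus : ℝ≥0∞) ^ (n + 2))⁻¹ * 2⁻¹ ^ n) :
    X.capacity (⋂ m, ⋃ n, H (m + n)) = 0 := by
  have hpow : Tendsto (fun m : ℕ => (2⁻¹ : ℝ≥0∞) ^ m) atTop (𝓝 0) :=
    ENNReal.tendsto_pow_atTop_nhds_zero_of_lt_one (by simp)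
  have hle : ∀ m, X.capacity (⋂ m, ⋃ n, H (m + n)) ≤ (X.modulus + 2) * 2⁻¹ ^ m := fun m =>
    calc X.capacity (⋂ m, ⋃ n, H (m + n)) ≤ X.capacity (∅ ∪ ⋃ n, H (m + n)) :=
          X.capacity_mono ((iInter_subset _ m).trans subset_union_right)
      _ ≤ X.modulus * 2⁻¹ ^ m + 2⁻¹ ^ m * 2 := by
          refine X.capacity_iUnion_add_le hH m ?_
          rw [X.capacity_empty]
          exact ENNReal.pow_pos (by simp) _
      _ = (X.modulus + 2) * 2⁻¹ ^ m := by ring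
  have hlim := ENNReal.Tendsto.const_mul (a := (X.modulus : ℝ≥0∞) + 2) hpow (Or.inr (by simp))
  rw [mul_zero] at hlim
  exact le_antisymm (ge_of_tendsto' hlim hle) zero_le

end QuasiBanachFunctionLattice

theorem EReal.ne_top_and_ne_bot_of_abs_sub_coe_ne_top {a : EReal} {b : ℝ}
    (h : (a - b).abs ≠ ∞) : a ≠ ⊤ ∧ a ≠ ⊥ := by
  constructor <;> rintro rfl <;> simp at h

theorem EReal.abs_toReal_sub_le {a : EReal} {b : ℝ} {c : ℝ≥0} (h : (a - b).abs ≤ c) :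
    |a.toReal - b| ≤ c := by
  lift a to ℝ using EReal.ne_top_and_ne_bot_of_abs_sub_coe_ne_top
    (ne_top_of_le_ne_top ENNReal.coe_ne_top h)
  rw [← EReal.coe_sub, EReal.abs_def, ENNReal.ofReal_le_coe] at h
  exact h

theorem mainTheorem7 {P : Type*} [MetricSpace P] [LocallyCompactSpace P]
    [MeasurableSpace P] [OpensMeasurableSpace P] (μ : Measure P) [SigmaFinite μ]
    (hμ : IsBorelRegular μ)
    (hball : ∀ (x : P) (r : ℝ), 0 < r → 0 < μ (Metric.ball x r) ∧ μ (Metric.ball x r) < ∞)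
    (X : QuasiBanachFunctionLattice μ)
    (hX : X.VitaliCaratheodory ∨ X.BoundedSetsAbsCont)
    (hdense : X.ContinuousDense) :
    ∀ u : P → EReal, X.MemNewton u → X.QuasiContinuous u := by
  intro u hu ε hε
  have hc0 : (X.modulus : ℝ≥0∞) ≠ 0 := (zero_lt_one.trans_le X.one_le_modulus').ne'
  have := secondCountableTopology_of_sigmaFinite_of_ball_pos μ fun x r hr => (hball x r hr).1
  have hfin : ∀ (x : P) (r : ℝ), μ (Metric.ball x r) < ∞ := by
    intro x r
    rcases lt_or_ge 0 r with hr | hr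
    · exact (hball x r hr).2
    · simp [Metric.ball_eq_empty.2 hr]
  -- continuous functions `v n` converging to `u` so fast that the sets `H n` are summable
  set η : ℕ → ℝ≥0 := fun n => 2⁻¹ ^ n * ((X.modulus ^ (n + 2))⁻¹ * 2⁻¹ ^ n) with hη
  have hη0 : ∀ n, 0 < η n := fun n => by
    have := zero_lt_one.trans_le X.one_le_modulus
    positivity
  have happrox : ∀ n, ∃ v : P → ℝ, Continuous v ∧
      X.capacity {x | (((2⁻¹ : ℝ≥0) ^ n : ℝ≥0) : ℝ≥0∞) < (u x - v x).abs} <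
        ((X.modulus : ℝ≥0∞) ^ (n + 2))⁻¹ * 2⁻¹ ^ n := by
    intro n
    obtain ⟨v, hv, hvN, hlt⟩ := hdense u hu (η n) (hη0 n)
    rw [ENNReal.ofReal_coe_nnreal] at hlt
    obtain ⟨δ, hδ, hδη⟩ := exists_between hlt
    refine ⟨v, hv, (X.capacity_lt_abs_le (hu.1.sub hvN.1) (a := 2⁻¹ ^ n) (by positivity)
      hδ).trans_lt ?_⟩
    have ha : (((2⁻¹ : ℝ≥0) ^ n)⁻¹ : ℝ≥0) ≠ 0 := by positivity
    refine ((ENNReal.mul_lt_mul_iff_right (by exact_mod_cast ha) ENNReal.coe_ne_top).2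
      hδη).trans_eq ?_
    rw [← ENNReal.coe_mul, hη]
    simp only
    rw [← mul_assoc, inv_mul_cancel₀ (by positivity), one_mul, ENNReal.coe_mul,
      ENNReal.coe_inv (pow_ne_zero _ (zero_lt_one.trans_le X.one_le_modulus).ne'),
      ENNReal.coe_pow, ENNReal.coe_pow, ENNReal.coe_inv two_ne_zero]
    rfl
  choose v hv hcap using happrox
  set H : ℕ → Set P := fun n =>
    {x | (((2⁻¹ : ℝ≥0) ^ n : ℝ≥0) : ℝ≥0∞) < (u x - v n x).abs} with hH
  have hHc : ∀ {n x}, x ∉ H n → (u x ≠ ⊤ ∧ u x ≠ ⊥) ∧ |(u x).toReal - v n x| ≤ 2⁻¹ ^ n := by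
    intro n x hx
    have hx : (u x - v n x).abs ≤ (((2⁻¹ : ℝ≥0) ^ n : ℝ≥0) : ℝ≥0∞) := not_lt.1 hx
    refine ⟨EReal.ne_top_and_ne_bot_of_abs_sub_coe_ne_top
      (ne_top_of_le_ne_top ENNReal.coe_ne_top hx), ?_⟩
    simpa using EReal.abs_toReal_sub_le hx
  -- the open set that controls the differences of consecutive approximations
  set F : ℕ → Set P := fun n => {x | 2 * 2⁻¹ ^ n < |v n x - v (n + 1) x|} with hF
  have hFo : ∀ n, IsOpen (F n) := fun n =>
    isOpen_lt continuous_const ((hv n).sub (hv (n + 1))).abs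
  have hFH : ∀ n, F n ⊆ H n ∪ H (n + 1) := by
    intro n x hx
    by_contra hxH
    rw [mem_union, not_or] at hxH
    have h1 := (hHc hxH.1).2
    have h2 := (hHc hxH.2).2
    have h3 : (2⁻¹ : ℝ) ^ (n + 1) ≤ 2⁻¹ ^ n :=
      pow_le_pow_of_le_one (by norm_num) (by norm_num) n.le_succ
    have h4 := abs_sub_le (v n x) (u x).toReal (v (n + 1) x)
    rw [abs_sub_comm (v n x) (u x).toReal] at h4
    have hx : 2 * 2⁻¹ ^ n < |v n x - v (n + 1) x| := hx
    linarith
  set e : ℝ≥0∞ := ENNReal.ofReal ε with he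
  have he0 : e / 2 ≠ 0 := by simp [he, hε]
  have heT : e / 2 ≠ ∞ := ENNReal.div_ne_top ENNReal.ofReal_ne_top two_ne_zero
  obtain ⟨O, hO, hEO, hOcap⟩ :=
    QuasiBanachFunctionLattice.exists_isOpen_capacity_lt_of_capacity_eq_zero
      hX hμ hfin (X.capacity_iInter_iUnion_eq_zero hcap) (ε := (X.modulus : ℝ≥0∞)⁻¹ * (e / 2))
      (by simp [he, hε])
  obtain ⟨m, hm⟩ : ∃ m : ℕ, (2⁻¹ : ℝ≥0∞) ^ m * 2 < e / 2 := by
    have hpow : Tendsto (fun m : ℕ => (2⁻¹ : ℝ≥0∞) ^ m * 2) atTop (𝓝 (0 * 2)) :=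
      ENNReal.Tendsto.mul_const
        (ENNReal.tendsto_pow_atTop_nhds_zero_of_lt_one (by simp)) (Or.inr (by simp))
    rw [zero_mul] at hpow
    exact (hpow.eventually (gt_mem_nhds (pos_iff_ne_zero.2 he0))).exists
  refine ⟨O ∪ ⋃ n, F (m + n), hO.union (isOpen_iUnion fun n => hFo _), ?_, ?_⟩
  · have hsub : O ∪ ⋃ n, F (m + n) ⊆ O ∪ ⋃ n, H (m + n) := by
      refine union_subset_union_right _ (iUnion_subset fun n => (hFH _).trans ?_)
      exact union_subset (subset_iUnion (fun n => H (m + n)) n)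
        (subset_iUnion (fun n => H (m + n)) (n + 1))
    refine (X.capacity_mono hsub).trans_lt ((X.capacity_iUnion_add_le hcap m hOcap).trans_lt ?_)
    rw [← mul_assoc, ENNReal.mul_inv_cancel hc0 ENNReal.coe_ne_top, one_mul]
    calc e / 2 + 2⁻¹ ^ m * 2 < e / 2 + e / 2 := ENNReal.add_lt_add_left heT hm
      _ = e := ENNReal.add_halves e
  -- off the exceptional set the approximations converge uniformly, and their limit is `u`
  have hpt : ∀ x ∈ (O ∪ ⋃ n, F (m + n))ᶜ, (u x ≠ ⊤ ∧ u x ≠ ⊥) ∧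
      ∀ n, dist (v (m + n) x) (u x).toReal ≤ 2 * 2⁻¹ ^ m * 2⁻¹ ^ n / (1 - 2⁻¹) := by
    intro x hx
    rw [mem_compl_iff, mem_union, not_or] at hx
    have hxE : x ∉ ⋂ m, ⋃ n, H (m + n) := fun h => hx.1 (hEO h)
    simp only [mem_iInter, mem_iUnion, not_forall, not_exists] at hxE
    obtain ⟨M, hM⟩ := hxE
    refine ⟨(hHc (hM 0)).1, ?_⟩
    refine dist_le_of_le_geometric_of_tendsto 2⁻¹ (2 * 2⁻¹ ^ m) (by norm_num) (fun n => ?_) ?_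
    · have hn : x ∉ F (m + n) := fun h => hx.2 (mem_iUnion.2 ⟨n, h⟩)
      rw [Real.dist_eq, mul_assoc, ← pow_add]
      exact not_lt.1 hn
    · have hlim : Tendsto (fun n => v n x) atTop (𝓝 (u x).toReal) := by
        rw [tendsto_iff_dist_tendsto_zero]
        refine squeeze_zero' (Eventually.of_forall fun _ => dist_nonneg) ?_
          (tendsto_pow_atTop_nhds_zero_of_lt_one (r := (2⁻¹ : ℝ)) (by norm_num) (by norm_num))
        filter_upwards [eventually_ge_atTop M] with n hn
        obtain ⟨k, rfl⟩ := Nat.exists_eq_add_of_le hn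
        rw [dist_comm, Real.dist_eq]
        exact (hHc (hM k)).2
      simpa only [add_comm m, Function.comp_def] using hlim.comp (tendsto_add_atTop_nat m)
  refine ⟨fun x hx => (hpt x hx).1, ?_⟩
  have hunif : TendstoUniformlyOn (fun n x => v (m + n) x) (fun x => (u x).toReal) atTop
      (O ∪ ⋃ n, F (m + n))ᶜ := by
    rw [Metric.tendstoUniformlyOn_iff]
    intro r hr
    have hlim : Tendsto (fun n : ℕ => 2 * 2⁻¹ ^ m * (2⁻¹ : ℝ) ^ n / (1 - 2⁻¹)) atTop (𝓝 0) := by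
      have := ((tendsto_pow_atTop_nhds_zero_of_lt_one (r := (2⁻¹ : ℝ)) (by norm_num)
        (by norm_num)).const_mul (2 * 2⁻¹ ^ m)).div_const (1 - 2⁻¹)
      simpa only [mul_zero, zero_div] using this
    filter_upwards [hlim.eventually (gt_mem_nhds hr)] with n hn x hx
    rw [dist_comm]
    exact ((hpt x hx).2 n).trans_lt hn
  have hcont := hunif.continuousOn (Frequently.of_forall fun n => (hv (m + n)).continuousOn)
  refine (continuous_coe_real_ereal.comp_continuousOn hcont).congr fun x hx => ?_
  exact (EReal.coe_toReal (hpt x hx).1.1 (hpt x hx).1.2).symm
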